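/- Let $N\ge 1$ and $k\ge 3$ be integers and $v=(c,d)\in(\mathbb Z/N\mathbb Z)^2$. Let $\Gamma(N)\subset \mathrm{SL}_2(\mathbb Z)$ be the principal congruence subgroup, acting on the upper half-plane $\mathbb H$ by Möbius transformations, and let $V_{k-2}$ be the space of homogeneous polynomials of degree $k-2$ in $(X,Y)$ with complex coefficients, with $P(X,Y)|_\gamma:=P(aX+bY,cX+dY)$ for $\gamma=\begin{pmatrix}a&b\\c&d\end{pmatrix}$. Real parts of polynomials are taken coefficientwise. Let $$G_k^v(\tau)=\sum_{\substack{(m,n)\in\mathbb Z^2\setminus\{(0,0)\}\\ (m,n)\equiv v \bmod N}}\frac1{(m\tau+n)^k},\qquad \underline{G}_k^v(z)=2\pi i\,G_k^v(z)\,(X-zY)^{k-2}\,dz .$$ Let $a_0$ be the constant term of the Fourier expansion of $G_k^v$ in powers of $q_N=e^{2\pi i\tau/N}$. For $0\le p\le k-2$ the regularised integral from $\tau$ to the unit tangent vector $\vec 1_\infty$ at the cusp $i\infty$ is $$\int_\tau^{\vec 1_\infty}G_k^v(z)\,z^p\,dz:=-\frac{a_0\tau^{p+1}}{p+1}+\int_\tau^{i\infty}\bigl(G_k^v(z)-a_0\bigr)z^p\,dz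 ,$$ extended linearly to $\int_\tau^{\vec 1_\infty}\underline G_k^v$, and $\int_{\vec 1_\infty}^\tau:=-\int_\tau^{\vec 1_\infty}$. With $\mathrm{Cl}_m(x)$ the real part (for $m$ odd) or the imaginary part (for $m$ even) of $\sum_{j\ge1}e^{ijx}/j^m$, put, for $u=(a,b)\in(\mathbb Z/N\mathbb Z)^2$, $(u|v):=ad-bc$, $$A_{\xi_k^u}:=(-1)^{k-1+\lceil k/2\rceil}\,\delta_{a,0}\,\frac{(k-2)!}{(2\pi)^{k-2}}\,\mathrm{Cl}_{k-1}\!\Bigl(\frac{2\pi b}{N}\Bigr),$$ $$A_{G_k^v}:=\frac{(-1)^{\lfloor k/2\rfloor}(2\pi)^k}{N^2(k-1)!}\sum_{u\in(\mathbb Z/N\mathbb Z)^2}A_{\xi_k^u}\cdot\begin{cases}\cos\frac{2\pi(u|v)}N,&k\text{ even},\\ \sin\frac{2\pi(u|v)}N,&k\text{ odd},\end{cases}\qquad P_{G_k^v}:=A_{G_k^v}\,Y^{k-2}.$$ Define $$\mathcal G_k^v(\tau):=P_{G_k^v}+\mathrm{Re}\int_{\vec 1_\infty}^\tau\underline G_k^v(z)\qquad(\tau\in\mathbb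 H).$$ Then $\mathcal G_k^v$ is a $V_{k-2}$-valued function on $\mathbb H$ which is modular equivariant for $\Gamma(N)$, that is, $$\mathcal G_k^v(\gamma\tau)|_\gamma=\mathcal G_k^v(\tau)\qquad\text{for all }\gamma\in\Gamma(N),\ \tau\in\mathbb H,$$ and it satisfies $d\mathcal G_k^v=\mathrm{Re}\,\underline G_k^v$ on $\mathbb H$. Moreover it is the only such function: every (real) differentiable $F:\mathbb H\to V_{k-2}$ with $dF=\mathrm{Re}\,\underline G_k^v$ and $F(\gamma\tau)|_\gamma=F(\tau)$ for all $\gamma\in\Gamma(N)$, $\tau\in\mathbb H$, equals $\mathcal G_k^v$. -/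

import Mathlib

open MeasureTheory UpperHalfPlane
open scoped MatrixGroups

noncomputable section

namespace EisensteinPrimitive

/-! ### Polynomials in `(X, Y)` -/

/-- Polynomials in two variables `(X, Y)` with complex coefficients; `X` is the variable of index
`0` and `Y` is the variable of index `1`. -/
abbrev Poly : Type := MvPolynomial (Fin 2) ℂ

/-- `V_n`: the homogeneous polynomials of degree `n` in `(X, Y)`. -/
abbrev V (n : ℕ) : Submodule ℂ Poly := MvPolynomial.homogeneousSubmodule (Fin 2) ℂ n

/-- The right action `P(X, Y)|_γ = P(aX + bY, cX + dY)`. -/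
def act (P : Poly) (γ : SL(2, ℤ)) : Poly :=
  MvPolynomial.aeval
    ![MvPolynomial.C ((γ 0 0 : ℤ) : ℂ) * MvPolynomial.X 0 +
        MvPolynomial.C ((γ 0 1 : ℤ) : ℂ) * MvPolynomial.X 1,
      MvPolynomial.C ((γ 1 0 : ℤ) : ℂ) * MvPolynomial.X 0 +
        MvPolynomial.C ((γ 1 1 : ℤ) : ℂ) * MvPolynomial.X 1] P

/-- The real part of a polynomial: complex conjugation acts on the coefficients and trivially on
`(X, Y)`. -/
def rePoly (P : Poly) : Poly :=
  MvPolynomial.C (1 / 2 : ℂ) * (P + MvPolynomial.map (starRingEnd ℂ) P)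

theorem coeff_rePoly (P : Poly) (m : Fin 2 →₀ ℕ) :
    (rePoly P).coeff m = (((P.coeff m).re : ℝ) : ℂ) := by
  simp only [rePoly, MvPolynomial.coeff_C_mul, MvPolynomial.coeff_add, MvPolynomial.coeff_map,
    Complex.add_conj]
  push_cast
  ring

/-! ### Equivariance and the differential equation -/

/-- `F(γτ)|_γ = F(τ)` for all `γ ∈ Γ(N)`. -/
def IsEquivariant (N : ℕ) (F : ℍ → Poly) : Prop :=
  ∀ γ ∈ CongruenceSubgroup.Gamma N, ∀ τ : ℍ, act (F (γ • τ)) γ = F τ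

/-- `dF = ω`, where `F` is a polynomial-valued function on `ℍ` and `ω` is a polynomial-valued
differential 1-form on `ℍ` (`ω τ h` is its value at the point `τ` on the tangent vector `h`):
every coefficient of `F` is real differentiable at every point, and its real Fréchet derivative
there is the corresponding coefficient of `ω`. -/
def HasDifferential (F : ℍ → Poly) (ω : ℍ → ℂ → Poly) : Prop :=
  ∀ (τ : ℍ) (m : Fin 2 →₀ ℕ), ∃ L : ℂ →L[ℝ] ℂ,
    (∀ h : ℂ, L h = (ω τ h).coeff m) ∧
      HasFDerivAt (fun z : ℂ => (F (ofComplex z)).coeff m) L (τ : ℂ)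

/-- The 1-form `2πi f(z) (X - zY)^(k-2) dz`. -/
def form (k : ℕ) (f : ℍ → ℂ) (z : ℍ) (h : ℂ) : Poly :=
  MvPolynomial.C (2 * Real.pi * Complex.I * f z * h) *
    (MvPolynomial.X 0 - MvPolynomial.C (z : ℂ) * MvPolynomial.X 1) ^ (k - 2)

/-! ### Eisenstein series -/

/-- `G_k^v(τ) = ∑' (mτ + n)^(-k)` over all `(m, n) ∈ ℤ² \ {(0,0)}` congruent to `v` mod `N`. -/
def eisG (N k : ℕ) (v : Fin 2 → ZMod N) (τ : ℍ) : ℂ :=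
  ∑' p : {p : Fin 2 → ℤ // p ≠ 0 ∧ ∀ i, (p i : ZMod N) = v i},
    1 / ((p.1 0 : ℂ) * (τ : ℂ) + (p.1 1 : ℂ)) ^ k

/-! ### Regularised integrals -/

/-- The constant term `a_0` of the Fourier expansion `f = ∑ a_n q_N^n`, `q_N = exp(2πiτ/N)`. -/
def constTerm (N : ℕ) (f : ℍ → ℂ) : ℂ :=
  (UpperHalfPlane.qExpansion (N : ℝ) f).coeff 0

/-- The regularised integral of `f(z) z^p dz` from `τ` to the unit tangent vector at `i∞`:
`-a_0 τ^(p+1)/(p+1) + ∫_τ^{i∞} (f(z) - a_0) z^p dz`,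
the last integral being taken along the vertical half-line `z = τ + it`, `t > 0`. -/
def regIntegral (N : ℕ) (f : ℍ → ℂ) (p : ℕ) (τ : ℍ) : ℂ :=
  -(constTerm N f * (τ : ℂ) ^ (p + 1) / ((p : ℂ) + 1)) +
    ∫ t in Set.Ioi (0 : ℝ),
      (f (ofComplex ((τ : ℂ) + t * Complex.I)) - constTerm N f) * ((τ : ℂ) + t * Complex.I) ^ p * Complex.I

/-- The regularised integral of the form `2πi f(z) (X - zY)^(k-2) dz` from `τ` to the unit tangent
vector at `i∞`, by binomial expansion of `(X - zY)^(k-2)` in powers of `z`. -/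
def regFormIntegral (N k : ℕ) (f : ℍ → ℂ) (τ : ℍ) : Poly :=
  ∑ p ∈ Finset.range (k - 2 + 1),
    MvPolynomial.C (2 * Real.pi * Complex.I * ((k - 2).choose p : ℂ) * (-1) ^ p * regIntegral N f p τ) *
      MvPolynomial.X 0 ^ (k - 2 - p) * MvPolynomial.X 1 ^ p

/-! ### The polynomial `P_{G_k^v}` -/

/-- The polylogarithm `Li_m(z) = ∑_{j ≥ 1} z^j / j^m`. -/
def polylog (m : ℕ) (z : ℂ) : ℂ := ∑' j : ℕ, z ^ (j + 1) / ((j : ℂ) + 1) ^ m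

/-- The Clausen function: the real part of `Li_m(e^{ix})` for `m` odd, and the imaginary part for
`m` even. -/
def clausen (m : ℕ) (x : ℝ) : ℝ :=
  if Odd m then (polylog m (Complex.exp (Complex.I * x))).re else (polylog m (Complex.exp (Complex.I * x))).im

/-- For `u = (a, b)`, the number
`A_{ξ_k^u} = (-1)^(k-1+⌈k/2⌉) δ_{a,0} (k-2)! / (2π)^(k-2) Cl_{k-1}(2πb/N)`. -/
def Axi (N k : ℕ) (u : Fin 2 → ZMod N) : ℝ :=
  (-1) ^ (k - 1 + (k + 1) / 2) * (if u 0 = 0 then 1 else 0) *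
    ((k - 2).factorial / (2 * Real.pi) ^ (k - 2)) *
    clausen (k - 1) (2 * Real.pi * (u 1).val / N)

/-- The symplectic pairing `(u|v) = md - nc` of `u = (m, n)` and `v = (c, d)`, modulo `N`. -/
def pairing {N : ℕ} (u v : Fin 2 → ZMod N) : ZMod N := u 0 * v 1 - u 1 * v 0

/-- The number `A_{G_k^v} = (-1)^⌊k/2⌋ (2π)^k / (N² (k-1)!) ∑_u A_{ξ_k^u} c(2π(u|v)/N)`, where `c` is
the cosine for `k` even and the sine for `k` odd. -/
def AG (N k : ℕ) [NeZero N] (v : Fin 2 → ZMod N) : ℝ :=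
  (-1) ^ (k / 2) * (2 * Real.pi) ^ k / ((N : ℝ) ^ 2 * (k - 1).factorial) *
    ∑ u : Fin 2 → ZMod N, Axi N k u *
      (if Even k then Real.cos (2 * Real.pi * (pairing u v).val / N)
        else Real.sin (2 * Real.pi * (pairing u v).val / N))

/-- `P_{G_k^v} = A_{G_k^v} Y^(k-2)`. -/
def PG (N k : ℕ) [NeZero N] (v : Fin 2 → ZMod N) : Poly :=
  MvPolynomial.C (AG N k v : ℂ) * MvPolynomial.X 1 ^ (k - 2)

/-- `P_{G_k^v} + Re ∫_{1_∞}^τ 2πi G_k^v(z) (X - zY)^(k-2) dz`; the regularised integral from the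
tangent vector to `τ` is minus the one from `τ` to the tangent vector. -/
def calG (N k : ℕ) [NeZero N] (v : Fin 2 → ZMod N) (τ : ℍ) : Poly :=
  PG N k v + rePoly (-regFormIntegral N k (eisG N k v) τ)

end EisensteinPrimitive

end

namespace EisensteinPrimitive

open Filter Topology ComplexConjugate

/-! ### Lattice sums -/

/-! The function `calG` is identified with an explicit real analytic Eisenstein series `realEis`
(`calG_eq_realEis`), whose equivariance is visible term by term: the forms mz + n, the polynomials X
- zY and Im z all transform by powers of cz + d and its conjugate, the powers cancel, and Γ(N)
permutes the lattice coset (`isEquivariant_realEis`).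

Both functions have differential Re(2πi G (X - zY)^(k-2) dz). For `calG` this is differentiation of
the regularised integral (`hasDifferential_calG`). For `realEis`, at a real point (x, y) with L = mx
+ ny nonzero, a geometric sum turns the term of index (m, n) into 2π/((k-1)L) · Im(((x - zy)/(mz +
n))^(k-1)), whose differential is the matching term of the form (`eisTerm_eq`,
`hasFDerivAt_eisTerm`, `hasFDerivAt_ev_realEis`). Hence `calG` - `realEis` is a constant polynomial
K.

To see that K = 0, evaluate at (X, Y) = (z, 1) over the point z itself: K(z, 1) = A + bulk(z) -
remainder(z), where A = `AG N k v`, `bulk` collects the terms with m ≠ 0, and `remainder` decays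
exponentially in Im z. Periodicity under z ↦ z + N makes K(z, 1) a number κ. Averaging over a
horizontal period, unfolding turns the sum over n into ∫ dx/((x + ib)(x - ib)^(k-1)) with b = my, so
the mean of `bulk` is a multiple of Σ 1/(|m| m^(k-2)) over nonzero m ≡ c (`integral_bulk`);
orthogonality of additive characters shows that A is exactly its negative (`ofReal_AG`). Letting Im
z → ∞ gives κ = 0.

Uniqueness: the difference of two solutions is a constant Γ(N)-invariant polynomial of degree k - 2
≥ 1, and such a polynomial is zero (`eq_zero_of_invariant`). -/

/-- The index set of the series defining `eisG N k v`. -/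
abbrev LatIdx (N : ℕ) (v : Fin 2 → ZMod N) : Type :=
  {p : Fin 2 → ℤ // p ≠ 0 ∧ ∀ i, (p i : ZMod N) = v i}

/-- The linear form `mz + n` attached to `p = (m, n)`. -/
def lin (p : Fin 2 → ℤ) (z : ℂ) : ℂ := (p 0 : ℂ) * z + (p 1 : ℂ)

theorem lin_conj (p : Fin 2 → ℤ) (z : ℂ) :
    lin p ((starRingEnd ℂ) z) = (starRingEnd ℂ) (lin p z) := by
  simp [lin]

theorem norm_lin_conj (p : Fin 2 → ℤ) (z : ℂ) : ‖lin p ((starRingEnd ℂ) z)‖ = ‖lin p z‖ := by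
  rw [lin_conj, RCLike.norm_conj]

theorem lin_ne_zero {p : Fin 2 → ℤ} (hp : p ≠ 0) {z : ℂ} (hz : 0 < z.im) : lin p z ≠ 0 := by
  intro h
  apply hp
  have h1 : (p 0 : ℝ) * z.im = 0 := by simpa [lin] using congrArg Complex.im h
  have h0 : p 0 = 0 := by
    rcases mul_eq_zero.1 h1 with h | h
    · exact_mod_cast h
    · exact absurd h hz.ne'
  have h2 : p 1 = 0 := by simpa [lin, h0] using h
  funext i
  fin_cases i
  · exact h0
  · exact h2

theorem hasDerivAt_lin (p : Fin 2 → ℤ) (z : ℂ) : HasDerivAt (lin p) (p 0 : ℂ) z := by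
  exact (((hasDerivAt_id z).const_mul (p 0 : ℂ)).add_const (p 1 : ℂ)).congr_deriv (mul_one _)

/-- Here `‖p‖` is the sup norm max(|m|, |n|). The uniformity in z on the half-strip supplies all the
dominating series below. -/
theorem exists_mul_norm_le_norm_lin (A : ℝ) {B : ℝ} (hB : 0 < B) :
    ∃ c : ℝ, 0 < c ∧ ∀ p : Fin 2 → ℤ, p ≠ 0 → ∀ z : ℂ, |z.re| ≤ A → B ≤ z.im →
      c * ‖p‖ ≤ ‖lin p z‖ := by
  refine ⟨EisensteinSeries.r ⟨⟨A, B⟩, hB⟩, EisensteinSeries.r_pos _, fun p hp z hA hz => ?_⟩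
  refine le_trans ?_ (EisensteinSeries.r_mul_max_le ⟨z, hB.trans_le hz⟩ hp)
  gcongr
  exact EisensteinSeries.r_lower_bound_on_verticalStrip _ hB ⟨hA, hz⟩

theorem summable_inv_norm_pow {k : ℕ} (hk : 3 ≤ k) :
    Summable fun p : Fin 2 → ℤ => (‖p‖ ^ k)⁻¹ := by
  have h : (2 : ℝ) < k := by exact_mod_cast hk
  refine (EisensteinSeries.summable_one_div_norm_rpow h).congr fun p => ?_
  rw [Real.rpow_neg (norm_nonneg _), Real.rpow_natCast]

theorem exists_summable_bound {k : ℕ} (hk : 3 ≤ k) (A : ℝ) {B : ℝ} (hB : 0 < B) :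
    ∃ u : (Fin 2 → ℤ) → ℝ, Summable u ∧ ∀ p : Fin 2 → ℤ, p ≠ 0 → ∀ z : ℂ, |z.re| ≤ A →
      B ≤ z.im → (‖lin p z‖ ^ k)⁻¹ ≤ u p := by
  obtain ⟨c, hc, h⟩ := exists_mul_norm_le_norm_lin A hB
  refine ⟨fun p => (c ^ k)⁻¹ * (‖p‖ ^ k)⁻¹, (summable_inv_norm_pow hk).mul_left _,
    fun p hp z hA hz => ?_⟩
  simp only
  rw [← mul_inv, ← mul_pow]
  have : 0 < c * ‖p‖ := mul_pos hc (norm_pos_iff.2 hp)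
  gcongr
  exact h p hp z hA hz

theorem summable_inv_norm_lin {N k : ℕ} (hk : 3 ≤ k) (v : Fin 2 → ZMod N) {z : ℂ}
    (hz : 0 < z.im) : Summable fun p : LatIdx N v => (‖lin p.1 z‖ ^ k)⁻¹ := by
  obtain ⟨u, hu, h⟩ := exists_summable_bound hk |z.re| hz
  exact Summable.of_nonneg_of_le (fun p => by positivity)
    (fun p => h p.1 p.2.1 z le_rfl le_rfl) (hu.subtype _)

theorem eisG_ofComplex {N k : ℕ} (v : Fin 2 → ZMod N) {z : ℂ} (hz : 0 < z.im) :
    eisG N k v (ofComplex z) = ∑' p : LatIdx N v, 1 / lin p.1 z ^ k := by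
  rw [ofComplex_apply_of_im_pos hz]
  rfl

/-- The series is dominated by a fixed summable family on an open half-strip around z, so the
Weierstrass theorem applies. -/
theorem differentiableAt_eisG {N k : ℕ} (hk : 3 ≤ k) (v : Fin 2 → ZMod N) {z : ℂ}
    (hz : 0 < z.im) : DifferentiableAt ℂ (fun w => eisG N k v (ofComplex w)) z := by
  obtain ⟨u, hu, h⟩ := exists_summable_bound hk (|z.re| + 1) (half_pos hz)
  let U : Set ℂ := {w | |w.re| < |z.re| + 1} ∩ {w | z.im / 2 < w.im}
  have hU : IsOpen U :=
    (isOpen_lt (by fun_prop) (by fun_prop)).inter (isOpen_lt (by fun_prop) (by fun_prop))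
  have hzU : z ∈ U := ⟨by simp, by simpa using half_lt_self hz⟩
  have hd : DifferentiableOn ℂ (fun w => ∑' p : LatIdx N v, 1 / lin p.1 w ^ k) U := by
    refine Complex.differentiableOn_tsum_of_summable_norm (hu.subtype _) (fun p w hw => ?_) hU
      (fun p w hw => ?_)
    · have hw0 : 0 < w.im := (half_pos hz).trans hw.2
      exact ((differentiableAt_const _).div ((hasDerivAt_lin p.1 w).differentiableAt.pow k)
        (pow_ne_zero _ (lin_ne_zero p.2.1 hw0))).differentiableWithinAt
    · simpa using h p.1 p.2.1 w hw.1.le hw.2.le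
  refine (hd.differentiableAt (hU.mem_nhds hzU)).congr_of_eventuallyEq ?_
  filter_upwards [hU.mem_nhds hzU] with w hw
  exact eisG_ofComplex v ((half_pos hz).trans hw.2)

/-! ### The action of the principal congruence subgroup -/

/-- The automorphy factor `cz + d`. -/
def den (γ : SL(2, ℤ)) (z : ℂ) : ℂ := (γ 1 0 : ℂ) * z + (γ 1 1 : ℂ)

theorem det_eq_one (γ : SL(2, ℤ)) : γ 0 0 * γ 1 1 - γ 0 1 * γ 1 0 = 1 := by
  have := γ.det_coe
  rwa [Matrix.det_fin_two] at this

theorem den_ne_zero (γ : SL(2, ℤ)) {z : ℂ} (hz : 0 < z.im) : den γ z ≠ 0 := by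
  refine lin_ne_zero (fun h => ?_) hz
  have h0 : γ 1 0 = 0 := congrFun h 0
  have h1 : γ 1 1 = 0 := congrFun h 1
  have := det_eq_one γ
  simp [h0, h1] at this

theorem coe_smul_eq (γ : SL(2, ℤ)) (τ : ℍ) :
    ((γ • τ : ℍ) : ℂ) = ((γ 0 0 : ℂ) * τ + (γ 0 1 : ℂ)) / den γ τ := by
  rw [coe_specialLinearGroup_apply]
  simp [den]

theorem lin_smul (γ : SL(2, ℤ)) (p : Fin 2 → ℤ) (τ : ℍ) :
    lin p ((γ • τ : ℍ) : ℂ) = lin (Matrix.vecMul p (γ : Matrix (Fin 2) (Fin 2) ℤ)) τ / den γ τ := by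
  have h := den_ne_zero γ τ.im_pos
  rw [coe_smul_eq, lin, eq_div_iff h, add_mul, mul_assoc, div_mul_cancel₀ _ h]
  simp only [lin, den, Matrix.vecMul, dotProduct, Fin.sum_univ_two]
  push_cast
  ring

theorem vecMul_cast {N : ℕ} {γ : SL(2, ℤ)} (hγ : γ ∈ CongruenceSubgroup.Gamma N)
    (p : Fin 2 → ℤ) (i : Fin 2) :
    ((Matrix.vecMul p (γ : Matrix (Fin 2) (Fin 2) ℤ) i : ℤ) : ZMod N) = p i := by
  obtain ⟨h0, h1, h2, h3⟩ := CongruenceSubgroup.Gamma_mem.1 hγ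
  fin_cases i <;> simp [Matrix.vecMul, dotProduct, Fin.sum_univ_two, h0, h1, h2, h3]

/-- Right multiplication by an element of `Γ(N)` permutes the index set. -/
def latEquiv {N : ℕ} (v : Fin 2 → ZMod N) {γ : SL(2, ℤ)}
    (hγ : γ ∈ CongruenceSubgroup.Gamma N) : LatIdx N v ≃ LatIdx N v where
  toFun p := ⟨Matrix.vecMul p.1 (γ : Matrix (Fin 2) (Fin 2) ℤ), by
    refine ⟨fun h => p.2.1 ?_, fun i => (vecMul_cast hγ p.1 i).trans (p.2.2 i)⟩
    have := congrArg (fun q => Matrix.vecMul q ((γ⁻¹ : SL(2, ℤ)) : Matrix (Fin 2) (Fin 2) ℤ)) h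
    simpa only [Matrix.vecMul_vecMul, ← Matrix.SpecialLinearGroup.coe_mul, mul_inv_cancel,
      Matrix.SpecialLinearGroup.coe_one, Matrix.vecMul_one, Matrix.zero_vecMul] using this⟩
  invFun p := ⟨Matrix.vecMul p.1 ((γ⁻¹ : SL(2, ℤ)) : Matrix (Fin 2) (Fin 2) ℤ), by
    refine ⟨fun h => p.2.1 ?_, fun i =>
      (vecMul_cast (Subgroup.inv_mem _ hγ) p.1 i).trans (p.2.2 i)⟩
    have := congrArg (fun q => Matrix.vecMul q (γ : Matrix (Fin 2) (Fin 2) ℤ)) h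
    simpa only [Matrix.vecMul_vecMul, ← Matrix.SpecialLinearGroup.coe_mul, inv_mul_cancel,
      Matrix.SpecialLinearGroup.coe_one, Matrix.vecMul_one, Matrix.zero_vecMul] using this⟩
  left_inv p := Subtype.ext <| by
    simp only [Matrix.vecMul_vecMul, ← Matrix.SpecialLinearGroup.coe_mul, mul_inv_cancel,
      Matrix.SpecialLinearGroup.coe_one, Matrix.vecMul_one]
  right_inv p := Subtype.ext <| by
    simp only [Matrix.vecMul_vecMul, ← Matrix.SpecialLinearGroup.coe_mul, inv_mul_cancel,
      Matrix.SpecialLinearGroup.coe_one, Matrix.vecMul_one]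

theorem eisG_smul {N : ℕ} (k : ℕ) (v : Fin 2 → ZMod N) {γ : SL(2, ℤ)}
    (hγ : γ ∈ CongruenceSubgroup.Gamma N) (τ : ℍ) :
    eisG N k v (γ • τ) = den γ τ ^ k * eisG N k v τ := by
  have h : ∀ σ : ℍ, eisG N k v σ = ∑' p : LatIdx N v, 1 / lin p.1 (σ : ℂ) ^ k := fun σ => rfl
  rw [h, h τ, ← (latEquiv v hγ).tsum_eq (fun p => 1 / lin p.1 (τ : ℂ) ^ k), ← tsum_mul_left]
  refine tsum_congr fun p => ?_
  rw [lin_smul, div_pow, one_div_div, ← mul_one_div]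
  rfl

/-! ### Translations by N and behaviour at the cusp. -/

theorem T_zpow_mem_Gamma (N : ℕ) (n : ℤ) :
    ModularGroup.T ^ ((N : ℤ) * n) ∈ CongruenceSubgroup.Gamma N := by
  rw [CongruenceSubgroup.Gamma_mem]
  simp [ModularGroup.coe_T_zpow]

theorem den_T_zpow (n : ℤ) (z : ℂ) : den (ModularGroup.T ^ n) z = 1 := by
  simp [den, ModularGroup.coe_T_zpow]

theorem eisG_vadd {N : ℕ} (k : ℕ) (v : Fin 2 → ZMod N) (n : ℤ) (τ : ℍ) :
    eisG N k v (((N * n : ℤ) : ℝ) +ᵥ τ) = eisG N k v τ := by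
  rw [← modular_T_zpow_smul, eisG_smul k v (T_zpow_mem_Gamma N n), den_T_zpow, one_pow, one_mul]

theorem periodic_eisG {N : ℕ} (k : ℕ) (v : Fin 2 → ZMod N) :
    Function.Periodic (eisG N k v ∘ ofComplex) ((N : ℝ) : ℂ) := by
  intro w
  by_cases hw : 0 < w.im
  · have hw' : 0 < (w + ((N : ℝ) : ℂ)).im := by simpa using hw
    have := eisG_vadd k v 1 (⟨w, hw⟩ : ℍ)
    simp only [Function.comp_apply]
    rw [ofComplex_apply_of_im_pos hw, ofComplex_apply_of_im_pos hw', ← this]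
    congr 1
    ext
    simp [add_comm]
  -- Off the upper half-plane `ofComplex` takes a single default value, so periodicity holds there
  -- trivially.
  · have hw' : (w + ((N : ℝ) : ℂ)).im ≤ 0 := by simpa using hw
    simp only [Function.comp_apply]
    rw [ofComplex_apply_eq_of_im_nonpos hw' (not_lt.1 hw)]

/-- The dominating series works only on vertical strips; a translation by a multiple of N first
moves τ into one. -/
theorem exists_bound_eisG {N : ℕ} [NeZero N] {k : ℕ} (hk : 3 ≤ k) (v : Fin 2 → ZMod N) {B : ℝ}
    (hB : 0 < B) : ∃ C : ℝ, ∀ τ : ℍ, B ≤ τ.im → ‖eisG N k v τ‖ ≤ C := by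
  obtain ⟨u, hu, h⟩ := exists_summable_bound hk N hB
  refine ⟨∑' p : LatIdx N v, u p.1, fun τ hτ => ?_⟩
  obtain ⟨n, hn⟩ := ModularGroup_T_zpow_mem_verticalStrip τ (NeZero.pos N)
  rw [modular_T_zpow_smul] at hn
  rw [← eisG_vadd k v n]
  refine tsum_of_norm_bounded (hu.subtype _).hasSum fun p => ?_
  simpa [lin] using h p.1 p.2.1 _ hn.1 (hτ.trans hn.2)

theorem mdifferentiable_eisG {N k : ℕ} (hk : 3 ≤ k) (v : Fin 2 → ZMod N) :
    MDifferentiable (modelWithCornersSelf ℂ ℂ) (modelWithCornersSelf ℂ ℂ) (eisG N k v) :=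
  UpperHalfPlane.mdifferentiable_iff.2 fun _ hz =>
    (differentiableAt_eisG hk v hz).differentiableWithinAt

theorem isBoundedAtImInfty_eisG {N : ℕ} [NeZero N] {k : ℕ} (hk : 3 ≤ k) (v : Fin 2 → ZMod N) :
    IsBoundedAtImInfty (eisG N k v) := by
  obtain ⟨C, hC⟩ := exists_bound_eisG hk v one_pos
  exact isBoundedAtImInfty_iff.2 ⟨C, 1, hC⟩

theorem constTerm_eq_valueAtInfty {N : ℕ} [NeZero N] {k : ℕ} (hk : 3 ≤ k) (v : Fin 2 → ZMod N) :
    constTerm N (eisG N k v) = valueAtInfty (eisG N k v) := by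
  have hN : (0 : ℝ) < N := by exact_mod_cast NeZero.pos N
  exact qExpansion_coeff_zero hN (analyticAt_cuspFunction_zero hN (periodic_eisG k v)
    (mdifferentiable_eisG hk v) (isBoundedAtImInfty_eisG hk v)) (periodic_eisG k v)

/-- `G_k^v` approaches its constant term exponentially fast. -/
theorem exists_decay_eisG {N : ℕ} [NeZero N] {k : ℕ} (hk : 3 ≤ k) (v : Fin 2 → ZMod N) {B : ℝ}
    (hB : 0 < B) : ∃ C c : ℝ, 0 < c ∧ ∀ τ : ℍ, B ≤ τ.im →
      ‖eisG N k v τ - constTerm N (eisG N k v)‖ ≤ C * Real.exp (-c * τ.im) := by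
  have hN : (0 : ℝ) < N := by exact_mod_cast NeZero.pos N
  rw [constTerm_eq_valueAtInfty hk v]
  set a := valueAtInfty (eisG N k v)
  have h := exp_decay_sub_atImInfty hN (periodic_eisG k v) (mdifferentiable_eisG hk v)
    (isBoundedAtImInfty_eisG hk v)
  obtain ⟨C₁, hC₁⟩ := h.bound
  obtain ⟨Y, hY⟩ := (atImInfty_mem _).1 hC₁
  obtain ⟨C₀, hC₀⟩ := exists_bound_eisG hk v hB
  set c : ℝ := 2 * Real.pi / N
  have hc : 0 < c := by positivity
  -- Decay at the cusp is known only for Im τ ≥ Y. Below that height the function is bounded, and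
  -- the factor exp(cY) compensates for the exponential.
  refine ⟨max C₁ ((C₀ + ‖a‖) * Real.exp (c * Y)), c, hc, fun τ hτ => ?_⟩
  rcases le_total Y τ.im with hYτ | hYτ
  · have := hY τ hYτ
    simp only [Set.mem_ofPred_eq, Real.norm_eq_abs, Real.abs_exp] at this
    refine this.trans ?_
    have e : -2 * Real.pi * τ.im / N = -c * τ.im := by simp only [c]; ring
    rw [e]
    gcongr
    exact le_max_left _ _
  · calc ‖eisG N k v τ - a‖ ≤ C₀ + ‖a‖ := (norm_sub_le _ _).trans (by gcongr; exact hC₀ τ hτ)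
      _ ≤ (C₀ + ‖a‖) * Real.exp (c * Y) * Real.exp (-c * τ.im) := by
          rw [mul_assoc, ← Real.exp_add]
          refine le_mul_of_one_le_right ?_ (Real.one_le_exp ?_)
          · exact add_nonneg ((norm_nonneg _).trans (hC₀ τ hτ)) (norm_nonneg _)
          · nlinarith
      _ ≤ _ := by gcongr; exact le_max_right _ _

/-- The constant term of `G_k^v` is the sum of the terms with `m = 0`. -/
theorem constTerm_eisG {N : ℕ} [NeZero N] {k : ℕ} (hk : 3 ≤ k) (v : Fin 2 → ZMod N) :
    constTerm N (eisG N k v) =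
      ∑' p : LatIdx N v, if p.1 0 = 0 then 1 / (p.1 1 : ℂ) ^ k else 0 := by
  obtain ⟨C, c, hc, hC⟩ := exists_decay_eisG hk v one_pos
  obtain ⟨u, hu, h⟩ := exists_summable_bound hk 0 one_pos
  have him : ∀ y : ℝ, ((y : ℂ) * Complex.I).im = y := fun y => by simp
  have h1 : Tendsto (fun y : ℝ => eisG N k v (ofComplex (y * Complex.I))) atTop
      (𝓝 (constTerm N (eisG N k v))) := by
    rw [tendsto_iff_norm_sub_tendsto_zero]
    refine squeeze_zero' (g := fun y => C * Real.exp (-c * y)) (.of_forall fun y => norm_nonneg _)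
      ?_ ?_
    · filter_upwards [eventually_ge_atTop 1] with y hy
      have hy0 : 0 < ((y : ℂ) * Complex.I).im := by rw [him]; linarith
      have := hC (ofComplex (y * Complex.I))
      rw [ofComplex_apply_of_im_pos hy0] at this ⊢
      have e : (⟨_, hy0⟩ : ℍ).im = y := him y
      rw [e] at this
      exact this hy
    · have : Tendsto (fun y : ℝ => Real.exp (-c * y)) atTop (𝓝 0) :=
        Real.tendsto_exp_atBot.comp (tendsto_id.const_mul_atTop_of_neg (neg_neg_of_pos hc))
      simpa using this.const_mul C
  have h2 : Tendsto (fun y : ℝ => ∑' p : LatIdx N v, 1 / lin p.1 (y * Complex.I) ^ k) atTop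
      (𝓝 (∑' p : LatIdx N v, if p.1 0 = 0 then 1 / (p.1 1 : ℂ) ^ k else 0)) := by
    refine tendsto_tsum_of_dominated_convergence (hu.subtype _) (fun p => ?_) ?_
    · split_ifs with hp
      · simp [lin, hp]
      · rw [tendsto_zero_iff_norm_tendsto_zero]
        have hp0 : 0 < |(p.1 0 : ℝ)| := abs_pos.2 (by exact_mod_cast hp)
        refine squeeze_zero' (g := fun y : ℝ => (|(p.1 0 : ℝ)| * y)⁻¹ ^ k)
          (.of_forall fun y => norm_nonneg _) ?_ ?_
        · filter_upwards [eventually_gt_atTop 0] with y hy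
          rw [norm_div, norm_one, norm_pow, one_div, ← inv_pow]
          gcongr
          refine le_trans (le_of_eq ?_) (Complex.abs_im_le_norm _)
          simp [lin, abs_mul, abs_of_pos hy]
        · have := ((tendsto_id.const_mul_atTop hp0).inv_tendsto_atTop).pow k
          simpa [zero_pow (by omega : k ≠ 0)] using! this
    · filter_upwards [eventually_ge_atTop 1] with y hy p
      have := h p.1 p.2.1 (y * Complex.I) (by simp) (by rw [him]; exact hy)
      simpa using this
  refine tendsto_nhds_unique h1 (h2.congr' ?_)
  filter_upwards [eventually_gt_atTop 0] with y hy
  exact (eisG_ofComplex v (by rw [him]; exact hy)).symm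

/-! ### Vertical integrals of rapidly decaying holomorphic functions -/

/-- `g` decays exponentially in vertical strips. -/
def DecaysOnStrips (g : ℂ → ℂ) : Prop :=
  ∀ A B : ℝ, 0 < B → ∃ C c : ℝ, 0 < c ∧ ∀ z : ℂ, |z.re| ≤ A → B ≤ z.im →
    ‖g z‖ ≤ C * Real.exp (-c * z.im)

/-- The integral of `g(w) dw` along the vertical half-line above `z`. -/
noncomputable def verticalIntegral (g : ℂ → ℂ) (z : ℂ) : ℂ :=
  ∫ t in Set.Ioi (0 : ℝ), g (z + t * Complex.I) * Complex.I

theorem pow_le_mul_exp (n : ℕ) {c y : ℝ} (hc : 0 < c) (hy : 0 ≤ y) :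
    y ^ n ≤ n.factorial / c ^ n * Real.exp (c * y) := by
  have h := Real.pow_div_factorial_le_exp (c * y) (by positivity) n
  rw [mul_pow] at h
  rw [div_mul_eq_mul_div, le_div_iff₀ (by positivity)]
  rw [div_le_iff₀ (by positivity)] at h
  linarith

/-- Half of the exponential rate absorbs the polynomial growth. -/
theorem DecaysOnStrips.mul_pow {g : ℂ → ℂ} (hg : DecaysOnStrips g) (n : ℕ) :
    DecaysOnStrips fun z => g z * z ^ n := by
  intro A B hB
  obtain ⟨C, c, hc, h⟩ := hg A B hB
  refine ⟨C * (n.factorial / (c / 2) ^ n * Real.exp (c / 2 * A)), c / 2, by positivity,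
    fun z hA hz => ?_⟩
  have hy : 0 < z.im := hB.trans_le hz
  have hA0 : 0 ≤ A := (abs_nonneg _).trans hA
  have hn : ‖z‖ ≤ A + z.im :=
    (Complex.norm_le_abs_re_add_abs_im z).trans (by rw [abs_of_pos hy]; gcongr)
  have hC := h z hA hz
  have hC' : 0 ≤ C * Real.exp (-c * z.im) := (norm_nonneg _).trans hC
  calc ‖g z * z ^ n‖ = ‖g z‖ * ‖z‖ ^ n := by rw [norm_mul, norm_pow]
    _ ≤ C * Real.exp (-c * z.im) * (A + z.im) ^ n := by gcongr
    _ ≤ C * Real.exp (-c * z.im) *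
        (n.factorial / (c / 2) ^ n * Real.exp (c / 2 * (A + z.im))) := by
      gcongr
      exact pow_le_mul_exp n (half_pos hc) (by positivity)
    _ = C * (n.factorial / (c / 2) ^ n) *
        (Real.exp (-c * z.im) * Real.exp (c / 2 * (A + z.im))) := by ring
    _ = C * (n.factorial / (c / 2) ^ n) *
        (Real.exp (c / 2 * A) * Real.exp (-(c / 2) * z.im)) := by
      rw [← Real.exp_add, ← Real.exp_add]; ring_nf
    _ = _ := by ring

theorem add_mul_I_re (z : ℂ) (t : ℝ) : (z + t * Complex.I).re = z.re := by simp

theorem add_mul_I_im (z : ℂ) (t : ℝ) : (z + t * Complex.I).im = z.im + t := by simp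

theorem integrableOn_vertical {g : ℂ → ℂ} (hd : ∀ z : ℂ, 0 < z.im → DifferentiableAt ℂ g z)
    (hg : DecaysOnStrips g) {z : ℂ} (hz : 0 < z.im) :
    IntegrableOn (fun t : ℝ => g (z + t * Complex.I)) (Set.Ioi 0) := by
  obtain ⟨C, c, hc, h⟩ := hg |z.re| z.im hz
  refine Integrable.mono' ((exp_neg_integrableOn_Ioi 0 hc).const_mul (C * Real.exp (-c * z.im)))
    (ContinuousOn.aestronglyMeasurable (fun t ht => ?_) measurableSet_Ioi)
    ((ae_restrict_mem measurableSet_Ioi).mono fun t ht => ?_)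
  · have hw : 0 < (z + t * Complex.I).im := by rw [add_mul_I_im]; exact add_pos hz ht
    exact ((hd _ hw).continuousAt.comp (f := fun t : ℝ => z + t * Complex.I)
      (by fun_prop)).continuousWithinAt
  · have ht' : 0 < t := ht
    refine (h _ (by rw [add_mul_I_re]) (by rw [add_mul_I_im]; linarith)).trans (le_of_eq ?_)
    rw [add_mul_I_im, mul_assoc, ← Real.exp_add]
    ring_nf

/-- Differentiating under the integral gives ∫ g'(z + it) i dt, which is the integral of d/dt g(z +
it) and so equals -g(z). The vertical path moves with z, so no contour has to be deformed. -/
theorem hasDerivAt_verticalIntegral {g : ℂ → ℂ}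
    (hd : ∀ z : ℂ, 0 < z.im → DifferentiableAt ℂ g z) (hg : DecaysOnStrips g) {z : ℂ}
    (hz : 0 < z.im) : HasDerivAt (verticalIntegral g) (-g z) z := by
  -- With this radius, the points of the ball have imaginary part at least 3ρ and the discs of
  -- radius ρ around them stay above height 2ρ, where the decay bound holds.
  set ρ : ℝ := z.im / 4
  have hρ : 0 < ρ := by positivity
  have hzρ : z.im = 4 * ρ := by simp only [ρ]; ring
  have hdo : DifferentiableOn ℂ g {w | 0 < w.im} := fun w hw => (hd w hw).differentiableWithinAt
  have hdd : ∀ w : ℂ, 0 < w.im → DifferentiableAt ℂ (deriv g) w := fun w hw =>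
    (hdo.deriv isOpen_upperHalfPlaneSet).differentiableAt (isOpen_upperHalfPlaneSet.mem_nhds hw)
  obtain ⟨C, c, hc, h⟩ := hg (|z.re| + 2 * ρ) (2 * ρ) (by positivity)
  have hC : 0 ≤ C := by
    have := (norm_nonneg _).trans (h z (by linarith) (by linarith))
    exact nonneg_of_mul_nonneg_left this (Real.exp_pos _)
  have hball : ∀ w ∈ Metric.ball z ρ, |w.re| ≤ |z.re| + ρ ∧ 3 * ρ ≤ w.im := by
    intro w hw
    rw [Metric.mem_ball, dist_eq_norm] at hw
    have h1 := (Complex.abs_re_le_norm (w - z)).trans hw.le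
    have h2 := (Complex.abs_im_le_norm (w - z)).trans hw.le
    rw [Complex.sub_re] at h1
    rw [Complex.sub_im] at h2
    have h3 := abs_le.1 h2
    constructor
    · calc |w.re| = |z.re + (w.re - z.re)| := by ring_nf
        _ ≤ _ := (abs_add_le _ _).trans (by gcongr)
    · linarith [h3.1]
  have hbound : ∀ t : ℝ, 0 < t → ∀ w ∈ Metric.ball z ρ,
      ‖deriv g (w + t * Complex.I)‖ ≤ C / ρ * Real.exp (-c * t) := by
    intro t ht w hw
    obtain ⟨h1, h2⟩ := hball w hw
    have key : ∀ w' ∈ Metric.closedBall (w + t * Complex.I) ρ,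
        |w'.re| ≤ |z.re| + 2 * ρ ∧ 2 * ρ + t ≤ w'.im := by
      intro w' hw'
      rw [Metric.mem_closedBall, dist_eq_norm] at hw'
      have h4 := (Complex.abs_re_le_norm _).trans hw'
      have h5 := (Complex.abs_im_le_norm _).trans hw'
      rw [Complex.sub_re, add_mul_I_re] at h4
      rw [Complex.sub_im, add_mul_I_im] at h5
      have h6 := abs_le.1 h5
      constructor
      · calc |w'.re| = |w.re + (w'.re - w.re)| := by ring_nf
          _ ≤ |w.re| + |w'.re - w.re| := abs_add_le _ _
          _ ≤ _ := by linarith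
      · linarith [h6.1]
    -- Cauchy's estimate transfers the exponential decay from g to its derivative.
    have hnorm := Complex.norm_deriv_le_of_forall_mem_sphere_norm_le (c := w + t * Complex.I)
      (C := C * Real.exp (-c * t)) (f := g) hρ ?_ ?_
    · rwa [mul_div_right_comm] at hnorm
    · refine DifferentiableOn.diffContOnCl fun w' hw' => ?_
      have := (key w' (Metric.closure_ball_subset_closedBall hw')).2
      exact (hd w' (by linarith)).differentiableWithinAt
    · intro w' hw'
      obtain ⟨h4, h5⟩ := key w' (Metric.sphere_subset_closedBall hw')
      refine (h w' h4 (by linarith)).trans ?_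
      exact mul_le_mul_of_nonneg_left (Real.exp_le_exp.2 (by nlinarith)) hC
  have hmeas : ∀ w : ℂ, 0 < w.im →
      AEStronglyMeasurable (fun t : ℝ => g (w + t * Complex.I)) (volume.restrict (Set.Ioi 0)) :=
    fun w hw => (integrableOn_vertical hd hg hw).aestronglyMeasurable
  have hmeas' : AEStronglyMeasurable (fun t : ℝ => deriv g (z + t * Complex.I))
      (volume.restrict (Set.Ioi 0)) := by
    refine ContinuousOn.aestronglyMeasurable (fun t ht => ?_) measurableSet_Ioi
    have hw : 0 < (z + t * Complex.I).im := by rw [add_mul_I_im]; exact add_pos hz ht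
    exact ((hdd _ hw).continuousAt.comp (f := fun t : ℝ => z + t * Complex.I)
      (by fun_prop)).continuousWithinAt
  have hball' : ∀ w ∈ Metric.ball z ρ, 0 < w.im := fun w hw => by linarith [(hball w hw).2]
  obtain ⟨hint, hder⟩ := hasDerivAt_integral_of_dominated_loc_of_deriv_le
    (F := fun w (t : ℝ) => g (w + t * Complex.I)) (F' := fun w t => deriv g (w + t * Complex.I))
    (bound := fun t => C / ρ * Real.exp (-c * t)) (Metric.ball_mem_nhds z hρ)
    (by filter_upwards [Metric.ball_mem_nhds z hρ] with w hw using hmeas w (hball' w hw))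
    (integrableOn_vertical hd hg hz) hmeas'
    ((ae_restrict_mem measurableSet_Ioi).mono fun t ht w hw => hbound t ht w hw)
    ((exp_neg_integrableOn_Ioi 0 hc).const_mul _)
    ((ae_restrict_mem measurableSet_Ioi).mono fun t ht w hw => by
      have ht' : 0 < t := ht
      have hw' : 0 < (w + t * Complex.I).im := by
        rw [add_mul_I_im]; exact add_pos (hball' w hw) ht
      simpa using (hd _ hw').hasDerivAt.comp_add_const w (t * Complex.I))
  have hftc : ∫ t in Set.Ioi (0 : ℝ), deriv g (z + t * Complex.I) * Complex.I = 0 - g z := by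
    have hlim : Tendsto (fun t : ℝ => g (z + t * Complex.I)) atTop (𝓝 0) := by
      rw [tendsto_zero_iff_norm_tendsto_zero]
      refine squeeze_zero' (g := fun t : ℝ => C * Real.exp (-c * t))
        (.of_forall fun _ => norm_nonneg _) ?_ ?_
      · filter_upwards [eventually_gt_atTop 0] with t ht
        refine (h _ (by rw [add_mul_I_re]; linarith) (by rw [add_mul_I_im]; linarith)).trans ?_
        rw [add_mul_I_im]
        exact mul_le_mul_of_nonneg_left (Real.exp_le_exp.2 (by nlinarith)) hC
      · simpa using (Real.tendsto_exp_atBot.comp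
          (tendsto_id.const_mul_atTop_of_neg (neg_neg_of_pos hc))).const_mul C
    have := integral_Ioi_of_hasDerivAt_of_tendsto' (a := 0)
      (f := fun t : ℝ => g (z + t * Complex.I)) (fun t ht => ?_) (hint.mul_const Complex.I) hlim
    · simpa using this
    · have ht' : 0 ≤ t := ht
      have hw : 0 < (z + t * Complex.I).im := by rw [add_mul_I_im]; linarith
      have h1 : HasDerivAt (fun s : ℝ => z + s * Complex.I) Complex.I t := by
        simpa using ((hasDerivAt_id t).ofReal_comp.mul_const Complex.I).const_add z
      exact (hd _ hw).hasDerivAt.comp t h1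
  have e : verticalIntegral g =
      fun w => (∫ t in Set.Ioi (0 : ℝ), g (w + t * Complex.I)) * Complex.I :=
    funext fun w => integral_mul_const _ _
  rw [e, ← zero_sub, ← hftc, integral_mul_const]
  exact hder.mul_const _

/-! ### The differential of the regularised integral -/

theorem decaysOnStrips_eisG {N : ℕ} [NeZero N] {k : ℕ} (hk : 3 ≤ k) (v : Fin 2 → ZMod N) :
    DecaysOnStrips fun z => eisG N k v (ofComplex z) - constTerm N (eisG N k v) := by
  intro A B hB
  obtain ⟨C, c, hc, h⟩ := exists_decay_eisG hk v hB
  refine ⟨C, c, hc, fun z _ hz => ?_⟩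
  have hz0 : 0 < z.im := hB.trans_le hz
  simp only
  rw [ofComplex_apply_of_im_pos hz0]
  exact h ⟨z, hz0⟩ hz

theorem regIntegral_ofComplex (N : ℕ) (f : ℍ → ℂ) (p : ℕ) {z : ℂ} (hz : 0 < z.im) :
    regIntegral N f p (ofComplex z) = -(constTerm N f * z ^ (p + 1) / ((p : ℂ) + 1)) +
      verticalIntegral (fun w => (f (ofComplex w) - constTerm N f) * w ^ p) z := by
  rw [ofComplex_apply_of_im_pos hz]
  rfl

/-- The boundary term -a_0 τ^(p+1)/(p+1) restores on differentiation exactly the a_0 subtracted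
under the integral. -/
theorem hasDerivAt_regIntegral {N : ℕ} [NeZero N] {k : ℕ} (hk : 3 ≤ k) (v : Fin 2 → ZMod N)
    (p : ℕ) {z : ℂ} (hz : 0 < z.im) :
    HasDerivAt (fun w => regIntegral N (eisG N k v) p (ofComplex w))
      (-(eisG N k v (ofComplex z) * z ^ p)) z := by
  set a := constTerm N (eisG N k v)
  have h1 := hasDerivAt_verticalIntegral
    (g := fun w => (eisG N k v (ofComplex w) - a) * w ^ p)
    (fun w hw => ((differentiableAt_eisG hk v hw).sub_const _).mul (differentiableAt_id.pow p))
    ((decaysOnStrips_eisG hk v).mul_pow p) hz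
  have h2 : HasDerivAt (fun w : ℂ => -(a * w ^ (p + 1) / ((p : ℂ) + 1))) (-(a * z ^ p)) z := by
    have hp : (p : ℂ) + 1 ≠ 0 := by exact_mod_cast p.succ_ne_zero
    refine (((hasDerivAt_pow (p + 1) z).const_mul a).div_const _).neg.congr_deriv ?_
    push_cast
    field_simp
  refine ((h2.add h1).congr_of_eventuallyEq ?_).congr_deriv (by ring)
  filter_upwards [isOpen_upperHalfPlaneSet.mem_nhds hz] with w hw
  exact regIntegral_ofComplex N _ p hw

/-- The binomial expansion of the form `2πi f(z) (X - zY)^(k-2) dz`. -/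
theorem form_eq_sum (k : ℕ) (f : ℍ → ℂ) (z : ℍ) (h : ℂ) :
    form k f z h = ∑ p ∈ Finset.range (k - 2 + 1),
      MvPolynomial.C (2 * Real.pi * Complex.I * ((k - 2).choose p : ℂ) * (-1) ^ p *
        (f z * z ^ p * h)) * MvPolynomial.X 0 ^ (k - 2 - p) * MvPolynomial.X 1 ^ p := by
  rw [form, sub_eq_neg_add, add_pow, Finset.mul_sum]
  refine Finset.sum_congr rfl fun p _ => ?_
  simp only [map_mul, map_pow, map_natCast, map_neg, map_one]
  rw [neg_pow, mul_pow]
  ring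

theorem hasDifferential_calG {N : ℕ} [NeZero N] {k : ℕ} (hk : 3 ≤ k) (v : Fin 2 → ZMod N) :
    HasDifferential (calG N k v) (fun τ h => rePoly (form k (eisG N k v) τ h)) := by
  intro τ m
  set e : ℕ → ℂ := fun p =>
    ((MvPolynomial.X 0 ^ (k - 2 - p) * MvPolynomial.X 1 ^ p : Poly)).coeff m
  set b : ℕ → ℂ := fun p => 2 * Real.pi * Complex.I * ((k - 2).choose p : ℂ) * (-1) ^ p
  set D : ℂ := ∑ p ∈ Finset.range (k - 2 + 1), b p * (eisG N k v τ * (τ : ℂ) ^ p) * e p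
  have h1 : HasDerivAt (fun z => (-regFormIntegral N k (eisG N k v) (ofComplex z)).coeff m)
      D (τ : ℂ) := by
    have h2 : HasDerivAt (fun z => -∑ p ∈ Finset.range (k - 2 + 1),
        b p * regIntegral N (eisG N k v) p (ofComplex z) * e p) D (τ : ℂ) := by
      refine (HasDerivAt.fun_sum fun p _ => (((hasDerivAt_regIntegral hk v p τ.im_pos).const_mul
        (b p)).mul_const (e p))).neg.congr_deriv ?_
      rw [ofComplex_apply, ← Finset.sum_neg_distrib]
      exact Finset.sum_congr rfl fun p _ => by ring
    convert h2 using 2 with z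
    rw [MvPolynomial.coeff_neg, regFormIntegral, MvPolynomial.coeff_sum]
    congr 1
    refine Finset.sum_congr rfl fun p _ => ?_
    rw [mul_assoc, MvPolynomial.coeff_C_mul]
  have h3 : ∀ h : ℂ, (form k (eisG N k v) τ h).coeff m = D * h := by
    intro h
    rw [form_eq_sum, MvPolynomial.coeff_sum, Finset.sum_mul]
    refine Finset.sum_congr rfl fun p _ => ?_
    rw [mul_assoc, MvPolynomial.coeff_C_mul]
    ring
  have h4 : HasFDerivAt (fun z => (-regFormIntegral N k (eisG N k v) (ofComplex z)).coeff m)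
      ((ContinuousLinearMap.toSpanSingleton ℂ D).restrictScalars ℝ) (τ : ℂ) :=
    h1.hasFDerivAt.restrictScalars ℝ
  refine ⟨(Complex.ofRealCLM.comp Complex.reCLM).comp
    ((ContinuousLinearMap.toSpanSingleton ℂ D).restrictScalars ℝ), fun h => ?_, ?_⟩
  · simp only [coeff_rePoly, h3]
    simp [mul_comm]
  · have h5 := ((Complex.ofRealCLM.comp Complex.reCLM).hasFDerivAt.comp (τ : ℂ) h4).const_add
      ((PG N k v).coeff m)
    refine h5.congr_of_eventuallyEq (.of_forall fun z => ?_)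
    simp only [calG, MvPolynomial.coeff_add, coeff_rePoly]
    rfl

/-! ### Homogeneity -/

theorem rePoly_mem_V {n : ℕ} {P : Poly} (hP : P ∈ V n) : rePoly P ∈ V n := by
  rw [rePoly, ← MvPolynomial.smul_eq_C_mul]
  refine Submodule.smul_mem _ _ (Submodule.add_mem _ hP ?_)
  exact MvPolynomial.IsHomogeneous.map hP _

theorem monomial_mem_V {n p : ℕ} (hp : p ≤ n) (c : ℂ) :
    (MvPolynomial.C c * MvPolynomial.X 0 ^ (n - p) * MvPolynomial.X 1 ^ p : Poly) ∈ V n := by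
  have h := ((MvPolynomial.isHomogeneous_C (Fin 2) c).mul
    ((MvPolynomial.isHomogeneous_X ℂ (0 : Fin 2)).pow (n - p))).mul
    ((MvPolynomial.isHomogeneous_X ℂ (1 : Fin 2)).pow p)
  have e : 0 + 1 * (n - p) + 1 * p = n := by omega
  rwa [e] at h

theorem calG_mem_V {N : ℕ} [NeZero N] (k : ℕ) (v : Fin 2 → ZMod N) (τ : ℍ) :
    calG N k v τ ∈ V (k - 2) := by
  refine Submodule.add_mem _ ?_ (rePoly_mem_V (Submodule.neg_mem _ (Submodule.sum_mem _
    fun p hp => monomial_mem_V (Nat.lt_succ_iff.1 (Finset.mem_range.1 hp)) _)))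
  simpa [PG] using monomial_mem_V (le_refl (k - 2)) (AG N k v : ℂ)

theorem form_mem_V (k : ℕ) (f : ℍ → ℂ) (z : ℍ) (h : ℂ) : form k f z h ∈ V (k - 2) := by
  rw [form_eq_sum]
  exact Submodule.sum_mem _
    fun p hp => monomial_mem_V (Nat.lt_succ_iff.1 (Finset.mem_range.1 hp)) _

/-! ### Evaluation of polynomials -/

/-- The value of a polynomial at `(x, y)`. -/
noncomputable def ev (x y : ℂ) : Poly →+* ℂ := MvPolynomial.eval ![x, y]

@[simp] theorem ev_C (x y c : ℂ) : ev x y (MvPolynomial.C c) = c := by simp [ev]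

@[simp] theorem ev_X_zero (x y : ℂ) : ev x y (MvPolynomial.X 0) = x := by simp [ev]

@[simp] theorem ev_X_one (x y : ℂ) : ev x y (MvPolynomial.X 1) = y := by simp [ev]

theorem ev_act (x y : ℂ) (P : Poly) (γ : SL(2, ℤ)) :
    ev x y (act P γ) =
      ev ((γ 0 0 : ℂ) * x + (γ 0 1 : ℂ) * y) ((γ 1 0 : ℂ) * x + (γ 1 1 : ℂ) * y) P := by
  rw [act, ev, ev, MvPolynomial.aeval_def, ← MvPolynomial.coe_eval₂Hom, ← RingHom.comp_apply]
  congr 1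
  refine MvPolynomial.ringHom_ext (fun r => by simp) (fun i => ?_)
  fin_cases i <;> simp

/-- The real part is coefficientwise, so at a non-real point the conjugate point enters too. It is
used at (τ, 1), where both τ and its conjugate appear. -/
theorem ev_rePoly (x y : ℂ) (P : Poly) :
    ev x y (rePoly P) = (ev x y P + conj (ev (conj x) (conj y) P)) / 2 := by
  have h : ev x y (MvPolynomial.map (starRingEnd ℂ) P) = conj (ev (conj x) (conj y) P) := by
    rw [ev, ev, MvPolynomial.eval_map, ← MvPolynomial.coe_eval₂Hom, ← RingHom.comp_apply]
    congr 1
    refine MvPolynomial.ringHom_ext (fun r => by simp) (fun i => ?_)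
    fin_cases i <;> simp
  rw [rePoly, map_mul, map_add, h, ev_C]
  ring

theorem ev_rePoly_real (x y : ℝ) (P : Poly) : ev x y (rePoly P) = ((ev x y P).re : ℂ) := by
  rw [ev_rePoly, Complex.conj_ofReal, Complex.conj_ofReal, Complex.add_conj]
  push_cast
  ring

/-- The index set depends only on n and not on the support of P, which allows termwise
differentiation when P varies with τ. -/
theorem ev_eq_sum {n : ℕ} {P : Poly} (hP : P ∈ V n) (x y : ℂ) :
    ev x y P = ∑ d ∈ Finset.univ.finsuppAntidiag n, P.coeff d * (x ^ d 0 * y ^ d 1) := by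
  rw [ev, MvPolynomial.eval_eq']
  simp only [Fin.prod_univ_two, Matrix.cons_val_zero, Matrix.cons_val_one]
  refine Finset.sum_subset (fun d hd => ?_) (fun d _ hd => ?_)
  · rw [Finset.mem_finsuppAntidiag]
    refine ⟨?_, Finset.subset_univ _⟩
    by_contra h
    refine MvPolynomial.mem_support_iff.1 hd (MvPolynomial.IsHomogeneous.coeff_eq_zero hP ?_)
    rwa [Finsupp.degree_eq_sum]
  · rw [MvPolynomial.notMem_support_iff.1 hd, zero_mul]

theorem ev_smul {n : ℕ} {P : Poly} (hP : P ∈ V n) (c x y : ℂ) :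
    ev (c * x) (c * y) P = c ^ n * ev x y P := by
  rw [ev_eq_sum hP, ev_eq_sum hP, Finset.mul_sum]
  refine Finset.sum_congr rfl fun d hd => ?_
  have h := (Finset.mem_finsuppAntidiag.1 hd).1
  rw [Fin.sum_univ_two] at h
  rw [← h, mul_pow, mul_pow, pow_add]
  ring

theorem hasFDerivAt_ev {n : ℕ} {F : ℍ → Poly} {ω : ℍ → ℂ → Poly} (hF : HasDifferential F ω)
    (hFV : ∀ τ, F τ ∈ V n) (hωV : ∀ τ h, ω τ h ∈ V n) (x y : ℂ) (τ : ℍ) :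
    ∃ L : ℂ →L[ℝ] ℂ, (∀ h, L h = ev x y (ω τ h)) ∧
      HasFDerivAt (fun z : ℂ => ev x y (F (ofComplex z))) L (τ : ℂ) := by
  choose L hL hL' using hF τ
  refine ⟨∑ d ∈ Finset.univ.finsuppAntidiag n, (x ^ d 0 * y ^ d 1) • L d, fun h => ?_, ?_⟩
  · rw [ev_eq_sum (hωV τ h)]
    simp [hL, mul_comm]
  · have := HasFDerivAt.fun_sum (u := Finset.univ.finsuppAntidiag n)
      fun d _ => (hL' d).const_mul (x ^ d 0 * y ^ d 1)
    refine this.congr_of_eventuallyEq (.of_forall fun z => ?_)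
    simp only
    rw [ev_eq_sum (hFV _)]
    exact Finset.sum_congr rfl fun d _ => mul_comm _ _

/-- A function on the upper half-plane with zero differential is constant. -/
theorem eq_of_hasFDerivAt_zero {g : ℂ → ℂ}
    (hg : ∀ z : ℂ, 0 < z.im → HasFDerivAt g (0 : ℂ →L[ℝ] ℂ) z) {z w : ℂ} (hz : 0 < z.im)
    (hw : 0 < w.im) : g z = g w := by
  have hc : Convex ℝ {z : ℂ | 0 < z.im} := convex_halfSpace_im_gt 0
  refine isOpen_upperHalfPlaneSet.is_const_of_fderiv_eq_zero (𝕜 := ℝ) hc.isPreconnected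
    (fun u hu => (hg u hu).differentiableAt.differentiableWithinAt)
    (fun u hu => (hg u hu).fderiv) hz hw

/-! ### The real analytic Eisenstein series -/

/-- The sum of `(mz + n)^(-r) (m z̄ + n)^(-s)`. -/
noncomputable def mixedSum (N : ℕ) (v : Fin 2 → ZMod N) (r s : ℕ) (z : ℂ) : ℂ :=
  ∑' p : LatIdx N v, 1 / (lin p.1 z ^ r * lin p.1 (conj z) ^ s)

/-- The vector valued real analytic Eisenstein series
`-2πy/(k-1) ∑_p ∑_j (X - zY)^j (X - z̄Y)^(k-2-j) / ((mz + n)^(j+1) (m z̄ + n)^(k-1-j))`. -/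
noncomputable def realEis (N k : ℕ) (v : Fin 2 → ZMod N) (τ : ℍ) : Poly :=
  ∑ j ∈ Finset.range (k - 1),
    MvPolynomial.C (-(2 * Real.pi / ((k : ℂ) - 1)) * τ.im * mixedSum N v (j + 1) (k - 1 - j) τ) *
      (MvPolynomial.X 0 - MvPolynomial.C (τ : ℂ) * MvPolynomial.X 1) ^ j *
      (MvPolynomial.X 0 - MvPolynomial.C (conj (τ : ℂ)) * MvPolynomial.X 1) ^ (k - 2 - j)

theorem summable_mixedSum {N k : ℕ} (hk : 3 ≤ k) (v : Fin 2 → ZMod N) {r s : ℕ} (hrs : r + s = k)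
    {z : ℂ} (hz : 0 < z.im) :
    Summable fun p : LatIdx N v => 1 / (lin p.1 z ^ r * lin p.1 (conj z) ^ s) := by
  refine Summable.of_norm ((summable_inv_norm_lin hk v hz).congr fun p => ?_)
  rw [norm_div, norm_mul, norm_pow, norm_pow, norm_lin_conj, ← pow_add, hrs, norm_one, one_div]

/-- The term of index `p` of the real analytic Eisenstein series, evaluated at `(x, y)`. -/
noncomputable def eisTerm (k : ℕ) (x y : ℂ) (p : Fin 2 → ℤ) (z : ℂ) : ℂ :=
  -(2 * Real.pi / ((k : ℂ) - 1)) * (z.im / (lin p z * lin p (conj z))) *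
    ∑ j ∈ Finset.range (k - 1),
      ((x - z * y) / lin p z) ^ j * ((x - conj z * y) / lin p (conj z)) ^ (k - 2 - j)

theorem hasSum_realEis {N k : ℕ} (hk : 3 ≤ k) (v : Fin 2 → ZMod N) (x y : ℂ) (τ : ℍ) :
    HasSum (fun p : LatIdx N v => eisTerm k x y p.1 τ) (ev x y (realEis N k v τ)) := by
  have h : ∀ j ∈ Finset.range (k - 1), HasSum (fun p : LatIdx N v =>
      -(2 * Real.pi / ((k : ℂ) - 1)) * τ.im *
        (1 / (lin p.1 τ ^ (j + 1) * lin p.1 (conj (τ : ℂ)) ^ (k - 1 - j))) *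
          (x - τ * y) ^ j * (x - conj (τ : ℂ) * y) ^ (k - 2 - j))
      (-(2 * Real.pi / ((k : ℂ) - 1)) * τ.im * mixedSum N v (j + 1) (k - 1 - j) τ *
          (x - τ * y) ^ j * (x - conj (τ : ℂ) * y) ^ (k - 2 - j)) := by
    intro j hj
    have hj' := Finset.mem_range.1 hj
    exact (((summable_mixedSum hk v (by omega) τ.im_pos).hasSum.mul_left _).mul_right _).mul_right _
  convert hasSum_sum h using 1
  · funext p
    rw [eisTerm, Finset.mul_sum]
    refine Finset.sum_congr rfl fun j hj => ?_
    have hj' := Finset.mem_range.1 hj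
    have e : k - 1 - j = (k - 2 - j) + 1 := by omega
    rw [e, pow_succ, pow_succ, div_pow, div_pow, coe_im]
    simp only [div_eq_mul_inv, mul_inv, one_mul]
    ring
  · simp [realEis, map_sum]

/-- Put A = (x - zy)/(mz + n). For real x, y the other ratio is the conjugate B of A, so the sum
over j is (A^(k-1) - B^(k-1))/(A - B), and A - B = -2i Im(z) (mx + ny)/|mz + n|². -/
theorem eisTerm_eq {k : ℕ} (hk : 3 ≤ k) (x y : ℝ) {p : Fin 2 → ℤ} (hp : p ≠ 0)
    (hL : (p 0 : ℝ) * x + p 1 * y ≠ 0) {z : ℂ} (hz : 0 < z.im) :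
    eisTerm k x y p z = ((2 * Real.pi / ((k : ℝ) - 1) / ((p 0 : ℝ) * x + p 1 * y) *
      ((((x : ℂ) - z * y) / lin p z) ^ (k - 1)).im : ℝ) : ℂ) := by
  have hk1 : (k : ℂ) - 1 ≠ 0 := by
    rw [sub_ne_zero]; exact_mod_cast (by omega : k ≠ 1)
  have hl := lin_ne_zero hp hz
  have hl' : lin p (conj z) ≠ 0 := by rw [lin_conj]; exact (map_ne_zero _).2 hl
  have hLc : ((p 0 : ℂ) * x + p 1 * y) ≠ 0 := by exact_mod_cast hL
  set A := ((x : ℂ) - z * y) / lin p z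
  set B := ((x : ℂ) - conj z * y) / lin p (conj z)
  have hB : conj A = B := by simp [A, B, lin_conj]
  have hgeom : (∑ j ∈ Finset.range (k - 1), A ^ j * B ^ (k - 2 - j)) * (A - B) =
      A ^ (k - 1) - B ^ (k - 1) := by
    rw [← Commute.geom_sum₂_mul (Commute.all A B)]
    rfl
  have hAB : A - B = -(2 * Complex.I * z.im * ((p 0 : ℂ) * x + p 1 * y)) /
      (lin p z * lin p (conj z)) := by
    have h2 : z - conj z = 2 * Complex.I * z.im := by
      rw [Complex.sub_conj]; push_cast; ring
    rw [div_sub_div _ _ hl hl', ← h2]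
    congr 1
    simp only [lin]
    ring
  have him : 2 * Complex.I * ((A ^ (k - 1)).im : ℂ) = A ^ (k - 1) - B ^ (k - 1) := by
    rw [← hB, ← map_pow, Complex.sub_conj]
    push_cast
    ring
  have h2I : 2 * Complex.I ≠ 0 := by simp
  have hT : eisTerm k x y p z = -(2 * Real.pi / ((k : ℂ) - 1)) *
    (z.im / (lin p z * lin p (conj z))) *
      ∑ j ∈ Finset.range (k - 1), A ^ j * B ^ (k - 2 - j) := rfl
  rw [hT, ← mul_right_inj' h2I]
  push_cast
  rw [mul_left_comm (2 * Complex.I) (2 * (Real.pi : ℂ) / ((k : ℂ) - 1) / _), him, ← hgeom, hAB]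
  generalize (∑ j ∈ Finset.range (k - 1), A ^ j * B ^ (k - 2 - j)) = S
  field_simp

theorem hasDerivAt_quotient_lin (x y : ℂ) {p : Fin 2 → ℤ} {z : ℂ} (hz : lin p z ≠ 0) :
    HasDerivAt (fun w => (x - w * y) / lin p w)
      (-(((p 0 : ℂ) * x + p 1 * y)) / lin p z ^ 2) z := by
  have h1 : HasDerivAt (fun w : ℂ => x - w * y) (-y) z := by
    simpa using ((hasDerivAt_id z).mul_const y).const_sub x
  refine (h1.div (hasDerivAt_lin p z) hz).congr_deriv ?_
  congr 1
  simp only [lin]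
  ring

/-- The derivative of (x - zy)/(mz + n) is -(mx + ny)/(mz + n)², so the prefactor cancels and -2π
Im((x - zy)^(k-2)/(mz + n)^k dz) remains. -/
theorem hasFDerivAt_eisTerm {k : ℕ} (hk : 3 ≤ k) (x y : ℝ) {p : Fin 2 → ℤ} (hp : p ≠ 0)
    (hL : (p 0 : ℝ) * x + p 1 * y ≠ 0) {z : ℂ} (hz : 0 < z.im) :
    HasFDerivAt (fun w => 2 * Real.pi / ((k : ℝ) - 1) / ((p 0 : ℝ) * x + p 1 * y) *
      ((((x : ℂ) - w * y) / lin p w) ^ (k - 1)).im)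
      ((-(2 * Real.pi)) • Complex.imCLM.comp ((ContinuousLinearMap.toSpanSingleton ℂ
        (((x : ℂ) - z * y) ^ (k - 2) / lin p z ^ k)).restrictScalars ℝ)) z := by
  have hk1 : (k : ℝ) - 1 ≠ 0 := by
    rw [sub_ne_zero]; exact_mod_cast (by omega : k ≠ 1)
  have hl := lin_ne_zero hp hz
  have hLc : ((p 0 : ℂ) * x + p 1 * y) ≠ 0 := by exact_mod_cast hL
  have h1 := ((hasDerivAt_quotient_lin (x : ℂ) y hl).pow (k - 1)).hasFDerivAt.restrictScalars ℝ
  have h2 := (Complex.imCLM.hasFDerivAt.comp z h1).const_mul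
    (2 * Real.pi / ((k : ℝ) - 1) / ((p 0 : ℝ) * x + p 1 * y))
  refine h2.congr_fderiv ?_
  ext h
  simp only [smul_apply, ContinuousLinearMap.comp_apply,
    ContinuousLinearMap.coe_restrictScalars', ContinuousLinearMap.toSpanSingleton_apply,
    smul_eq_mul, Complex.imCLM_apply]
  have e : h * (((k - 1 : ℕ) : ℂ) * (((x : ℂ) - z * y) / lin p z) ^ (k - 1 - 1) *
      (-(((p 0 : ℂ) * x + p 1 * y)) / lin p z ^ 2)) =
      ((-(((k : ℝ) - 1) * ((p 0 : ℝ) * x + p 1 * y)) : ℝ) : ℂ) *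
        (h * (((x : ℂ) - z * y) ^ (k - 2) / lin p z ^ k)) := by
    obtain ⟨n, rfl⟩ : ∃ n, k = n + 2 := ⟨k - 2, by omega⟩
    simp only [Nat.add_sub_cancel, show n + 2 - 1 = n + 1 from rfl]
    push_cast
    rw [div_pow, pow_add]
    field_simp
    ring
  rw [e, Complex.im_ofReal_mul]
  field_simp

/-- A real point `(x, y)` on which no nonzero integral linear form vanishes. -/
def IsGeneric (x y : ℝ) : Prop := ∀ p : Fin 2 → ℤ, p ≠ 0 → (p 0 : ℝ) * x + p 1 * y ≠ 0

theorem isGeneric_one {t : ℝ} (ht : Irrational t) : IsGeneric 1 t := by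
  intro p hp h
  rcases eq_or_ne (p 1) 0 with h1 | h1
  · apply hp
    have h0 : p 0 = 0 := by simpa [h1] using h
    funext i
    fin_cases i
    · exact h0
    · exact h1
  · refine ht ⟨-(p 0 : ℚ) / p 1, ?_⟩
    have h1' : (p 1 : ℝ) ≠ 0 := by exact_mod_cast h1
    push_cast
    field_simp
    linarith

/-- Termwise differentiation: near τ the derivatives are dominated by a constant times the summable
lattice bound. Genericity keeps every denominator mx + ny away from 0. -/
theorem hasFDerivAt_ev_realEis {N k : ℕ} (hk : 3 ≤ k) (v : Fin 2 → ZMod N) {x y : ℝ}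
    (hxy : IsGeneric x y) (τ : ℍ) :
    ∃ L : ℂ →L[ℝ] ℂ,
      (∀ h : ℂ, L h = (((2 * Real.pi * Complex.I * eisG N k v τ * h) *
        ((x : ℂ) - τ * y) ^ (k - 2)).re : ℂ)) ∧
      HasFDerivAt (fun z : ℂ => ev x y (realEis N k v (ofComplex z))) L (τ : ℂ) := by
  set z₀ : ℂ := (τ : ℂ)
  have hz₀ : 0 < z₀.im := τ.im_pos
  set ρ : ℝ := z₀.im / 2
  have hρ : 0 < ρ := half_pos hz₀
  have hball : ∀ z ∈ Metric.ball z₀ ρ, |z.re| ≤ |z₀.re| + ρ ∧ ρ ≤ z.im ∧ ‖z‖ ≤ ‖z₀‖ + ρ := by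
    intro z hz
    rw [Metric.mem_ball, dist_eq_norm] at hz
    have h1 := (Complex.abs_re_le_norm (z - z₀)).trans hz.le
    have h2 := (Complex.abs_im_le_norm (z - z₀)).trans hz.le
    rw [Complex.sub_re] at h1
    rw [Complex.sub_im] at h2
    have h3 := abs_le.1 h2
    have h4 : z₀.im = 2 * ρ := by simp only [ρ]; ring
    refine ⟨?_, by linarith [h3.1], ?_⟩
    · calc |z.re| = |z₀.re + (z.re - z₀.re)| := by ring_nf
        _ ≤ _ := (abs_add_le _ _).trans (by gcongr)
    · calc ‖z‖ = ‖z₀ + (z - z₀)‖ := by ring_nf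
        _ ≤ _ := (norm_add_le _ _).trans (by gcongr)
  obtain ⟨u, hu, hub⟩ := exists_summable_bound hk (|z₀.re| + ρ) hρ
  -- Bounds 2π |x - zy|^(k-2) uniformly for z in the ball.
  set M : ℝ := 2 * Real.pi * (|x| + (‖z₀‖ + ρ) * |y|) ^ (k - 2)
  let f : LatIdx N v → ℂ → ℝ := fun p w =>
    2 * Real.pi / ((k : ℝ) - 1) / ((p.1 0 : ℝ) * x + p.1 1 * y) *
      ((((x : ℂ) - w * y) / lin p.1 w) ^ (k - 1)).im
  let f' : LatIdx N v → ℂ → (ℂ →L[ℝ] ℝ) := fun p z =>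
    (-(2 * Real.pi)) • Complex.imCLM.comp ((ContinuousLinearMap.toSpanSingleton ℂ
        (((x : ℂ) - z * y) ^ (k - 2) / lin p.1 z ^ k)).restrictScalars ℝ)
  have hf : ∀ (p : LatIdx N v) (z : ℂ), z ∈ Metric.ball z₀ ρ → HasFDerivAt (f p) (f' p z) z :=
    fun p z hz => hasFDerivAt_eisTerm hk x y p.2.1 (hxy p.1 p.2.1) (hρ.trans_le (hball z hz).2.1)
  have hf' : ∀ (p : LatIdx N v) (z : ℂ), z ∈ Metric.ball z₀ ρ → ‖f' p z‖ ≤ M * u p.1 := by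
    intro p z hz
    obtain ⟨h1, h2, h3⟩ := hball z hz
    refine ContinuousLinearMap.opNorm_le_bound _ (mul_nonneg (by positivity)
      ((by positivity : (0 : ℝ) ≤ (‖lin p.1 z‖ ^ k)⁻¹).trans (hub p.1 p.2.1 z h1 h2)))
      fun h => ?_
    have e : f' p z h = -(2 * Real.pi) *
        (h * (((x : ℂ) - z * y) ^ (k - 2) / lin p.1 z ^ k)).im := rfl
    have h4 : ‖(x : ℂ) - z * y‖ ≤ |x| + (‖z₀‖ + ρ) * |y| := by
      refine (norm_sub_le _ _).trans ?_
      rw [norm_mul, Complex.norm_real, Complex.norm_real, Real.norm_eq_abs, Real.norm_eq_abs]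
      gcongr
    rw [e, norm_mul, norm_neg, Real.norm_of_nonneg Real.two_pi_pos.le]
    calc 2 * Real.pi * ‖(h * (((x : ℂ) - z * y) ^ (k - 2) / lin p.1 z ^ k)).im‖
        ≤ 2 * Real.pi * ‖h * (((x : ℂ) - z * y) ^ (k - 2) / lin p.1 z ^ k)‖ := by
          gcongr
          exact Complex.abs_im_le_norm _
      _ = 2 * Real.pi * (‖(x : ℂ) - z * y‖ ^ (k - 2) * (‖lin p.1 z‖ ^ k)⁻¹) * ‖h‖ := by
          rw [norm_mul, norm_div, norm_pow, norm_pow]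
          ring
      _ ≤ 2 * Real.pi * ((|x| + (‖z₀‖ + ρ) * |y|) ^ (k - 2) * u p.1) * ‖h‖ := by
          gcongr
          exact hub p.1 p.2.1 z h1 h2
      _ = M * u p.1 * ‖h‖ := by ring
  have hmem : z₀ ∈ Metric.ball z₀ ρ := Metric.mem_ball_self hρ
  have hev : ∀ z : ℂ, 0 < z.im → HasSum (fun p : LatIdx N v => ((f p z : ℝ) : ℂ))
      (ev x y (realEis N k v (ofComplex z))) := by
    intro z hz
    rw [ofComplex_apply_of_im_pos hz]
    refine (hasSum_realEis hk v x y ⟨z, hz⟩).congr_fun ?_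
    intro p
    exact (eisTerm_eq hk x y p.2.1 (hxy p.1 p.2.1) hz).symm
  have hsum : Summable fun p : LatIdx N v => f p z₀ :=
    Complex.summable_ofReal.1 (hev z₀ hz₀).summable
  have hder := hasFDerivAt_tsum_of_isPreconnected ((hu.subtype _).mul_left M) Metric.isOpen_ball
    (convex_ball z₀ ρ).isPreconnected hf hf' hmem hsum hmem
  have hf's : Summable fun p : LatIdx N v => f' p z₀ :=
    Summable.of_norm_bounded ((hu.subtype _).mul_left M) fun p => hf' p z₀ hmem
  refine ⟨Complex.ofRealCLM.comp (∑' p, f' p z₀), fun h => ?_, ?_⟩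
  · have h1 : (∑' p, f' p z₀) h = ∑' p, f' p z₀ h :=
      (ContinuousLinearMap.apply ℝ ℝ h).map_tsum hf's
    have h2 : Summable fun p : LatIdx N v => 1 / lin p.1 z₀ ^ k :=
      Summable.of_norm ((summable_inv_norm_lin hk v hz₀).congr fun p => by simp)
    have h3 : HasSum (fun p : LatIdx N v => f' p z₀ h)
        (-(2 * Real.pi) * (h * (((x : ℂ) - z₀ * y) ^ (k - 2) * eisG N k v τ)).im) := by
      refine HasSum.mul_left _ (Complex.hasSum_im (HasSum.mul_left h ?_))
      simp_rw [div_eq_mul_one_div (((x : ℂ) - z₀ * y) ^ (k - 2))]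
      exact h2.hasSum.mul_left _
    rw [ContinuousLinearMap.comp_apply, h1, h3.tsum_eq, Complex.ofRealCLM_apply]
    congr 1
    have e : 2 * Real.pi * Complex.I * eisG N k v τ * h * ((x : ℂ) - z₀ * y) ^ (k - 2) =
      ((2 * Real.pi : ℝ) : ℂ) * (Complex.I * (h * (((x : ℂ) - z₀ * y) ^ (k - 2) * eisG N k v τ))) := by
      push_cast
      ring
    rw [e, Complex.re_ofReal_mul, Complex.I_mul_re]
    ring
  · refine (Complex.ofRealCLM.hasFDerivAt.comp z₀ hder).congr_of_eventuallyEq ?_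
    filter_upwards [isOpen_upperHalfPlaneSet.mem_nhds hz₀] with z hz
    rw [← (hev z hz).tsum_eq]
    exact (Complex.ofReal_tsum _).symm

/-! ### Equivariance of the real analytic Eisenstein series -/

theorem mixedSum_smul {N : ℕ} (v : Fin 2 → ZMod N) (r s : ℕ) {γ : SL(2, ℤ)}
    (hγ : γ ∈ CongruenceSubgroup.Gamma N) (τ : ℍ) :
    mixedSum N v r s ((γ • τ : ℍ) : ℂ) =
      den γ τ ^ r * conj (den γ τ) ^ s * mixedSum N v r s τ := by
  rw [mixedSum, mixedSum, ← (latEquiv v hγ).tsum_eq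
    (fun p => 1 / (lin p.1 (τ : ℂ) ^ r * lin p.1 (conj (τ : ℂ)) ^ s)), ← tsum_mul_left]
  refine tsum_congr fun p => ?_
  rw [lin_conj, lin_conj, lin_smul, map_div₀, div_pow, div_pow, div_mul_div_comm, one_div_div,
    ← mul_one_div]
  rfl

theorem ofReal_im_smul (γ : SL(2, ℤ)) (τ : ℍ) :
    ((γ • τ : ℍ).im : ℂ) = τ.im / (den γ τ * conj (den γ τ)) := by
  have h : (γ • τ : ℍ).im = τ.im / Complex.normSq (den γ τ) := by
    have := ModularGroup.im_smul_eq_div_normSq γ τ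
    rw [this]
    congr 2
  rw [h, Complex.mul_conj]
  push_cast
  rfl

/-- Both coefficients a - wc and b - wd simplify because ad - bc = 1. The point z is an arbitrary
complex number because the conjugate of τ is needed as well. -/
theorem act_linear_form (γ : SL(2, ℤ)) {z w d : ℂ} (hd : d ≠ 0)
    (hdz : d = (γ 1 0 : ℂ) * z + (γ 1 1 : ℂ))
    (hw : w = ((γ 0 0 : ℂ) * z + (γ 0 1 : ℂ)) / d) :
    act (MvPolynomial.X 0 - MvPolynomial.C w * MvPolynomial.X 1) γ =
      MvPolynomial.C d⁻¹ * (MvPolynomial.X 0 - MvPolynomial.C z * MvPolynomial.X 1) := by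
  have hdet : ((γ 0 0 : ℤ) : ℂ) * (γ 1 1 : ℤ) - (γ 0 1 : ℤ) * (γ 1 0 : ℤ) = 1 := by
    exact_mod_cast det_eq_one γ
  have h1 : ((γ 0 0 : ℤ) : ℂ) - w * (γ 1 0 : ℤ) = d⁻¹ := by
    rw [hw]
    field_simp
    rw [hdz]
    linear_combination hdet
  have h2 : ((γ 0 1 : ℤ) : ℂ) - w * (γ 1 1 : ℤ) = -(d⁻¹ * z) := by
    rw [hw]
    field_simp
    rw [hdz]
    linear_combination -z * hdet
  have e : act (MvPolynomial.X 0 - MvPolynomial.C w * MvPolynomial.X 1) γ =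
      MvPolynomial.C (((γ 0 0 : ℤ) : ℂ) - w * (γ 1 0 : ℤ)) * MvPolynomial.X 0 +
      MvPolynomial.C (((γ 0 1 : ℤ) : ℂ) - w * (γ 1 1 : ℤ)) * MvPolynomial.X 1 := by
    simp only [act, map_sub, map_mul, MvPolynomial.aeval_X, Matrix.cons_val_zero,
      Matrix.cons_val_one, MvPolynomial.aeval_C, MvPolynomial.algebraMap_eq]
    ring
  rw [e, h1, h2]
  simp only [map_neg, map_mul]
  ring

theorem isEquivariant_realEis {N k : ℕ} (v : Fin 2 → ZMod N) :
    IsEquivariant N (realEis N k v) := by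
  intro γ hγ τ
  have hd := den_ne_zero γ τ.im_pos
  have hd' : conj (den γ τ) ≠ 0 := (map_ne_zero _).2 hd
  have h1 := act_linear_form γ hd (z := (τ : ℂ)) rfl (coe_smul_eq γ τ)
  have h2 := act_linear_form γ hd' (z := conj (τ : ℂ)) (w := conj ((γ • τ : ℍ) : ℂ))
    (by simp [den]) (by rw [coe_smul_eq]; simp)
  have hC : ∀ c : ℂ, act (MvPolynomial.C c) γ = MvPolynomial.C c := fun c => by simp [act]
  have hmul : ∀ P Q : Poly, act (P * Q) γ = act P γ * act Q γ := fun P Q => by simp [act]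
  have hpow : ∀ (P : Poly) (n : ℕ), act (P ^ n) γ = act P γ ^ n := fun P n => by simp [act]
  have hsum : act (realEis N k v (γ • τ)) γ = ∑ j ∈ Finset.range (k - 1), act
      (MvPolynomial.C (-(2 * Real.pi / ((k : ℂ) - 1)) * (γ • τ : ℍ).im *
        mixedSum N v (j + 1) (k - 1 - j) ((γ • τ : ℍ) : ℂ)) *
      (MvPolynomial.X 0 - MvPolynomial.C ((γ • τ : ℍ) : ℂ) * MvPolynomial.X 1) ^ j *
      (MvPolynomial.X 0 - MvPolynomial.C (conj ((γ • τ : ℍ) : ℂ)) * MvPolynomial.X 1) ^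
        (k - 2 - j)) γ := by
    simp only [realEis, act, map_sum]
  rw [hsum, realEis]
  refine Finset.sum_congr rfl fun j hj => ?_
  have hj' := Finset.mem_range.1 hj
  rw [hmul, hmul, hpow, hpow, hC, h1, h2, ofReal_im_smul, mixedSum_smul v _ _ hγ, mul_pow, mul_pow,
    ← map_pow, ← map_pow]
  have e : k - 1 - j = (k - 2 - j) + 1 := by omega
  rw [e]
  generalize (MvPolynomial.X 0 - MvPolynomial.C (τ : ℂ) * MvPolynomial.X 1 : Poly) ^ j = P
  generalize (MvPolynomial.X 0 - MvPolynomial.C (conj (τ : ℂ)) * MvPolynomial.X 1 : Poly) ^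
    (k - 2 - j) = Q
  -- The lattice sum contributes exponents j + 1 and k - 1 - j of the automorphy factor and its
  -- conjugate, the linear forms -j and -(k - 2 - j), and the imaginary part -1 and -1; the total is
  -- zero.
  have hc : -(2 * Real.pi / ((k : ℂ) - 1)) * (τ.im / (den γ τ * conj (den γ τ))) *
      (den γ τ ^ (j + 1) * conj (den γ τ) ^ (k - 2 - j + 1) *
        mixedSum N v (j + 1) (k - 2 - j + 1) τ) * (den γ τ)⁻¹ ^ j *
        (conj (den γ τ))⁻¹ ^ (k - 2 - j) =
      -(2 * Real.pi / ((k : ℂ) - 1)) * τ.im * mixedSum N v (j + 1) (k - 2 - j + 1) τ := by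
    rw [inv_pow, inv_pow, pow_succ, pow_succ]
    field_simp
  rw [← hc]
  simp only [map_mul, map_pow]
  ring

theorem realEis_mem_V {N k : ℕ} (v : Fin 2 → ZMod N) (τ : ℍ) : realEis N k v τ ∈ V (k - 2) := by
  refine Submodule.sum_mem _ fun j hj => ?_
  have hj' := Finset.mem_range.1 hj
  have hlin : ∀ c : ℂ, (MvPolynomial.X 0 - MvPolynomial.C c * MvPolynomial.X 1 : Poly) ∈ V 1 := by
    intro c
    refine Submodule.sub_mem _ (MvPolynomial.isHomogeneous_X _ _) ?_
    simpa using (MvPolynomial.isHomogeneous_C (Fin 2) c).mul (MvPolynomial.isHomogeneous_X ℂ 1)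
  have h := ((MvPolynomial.isHomogeneous_C (Fin 2) (-(2 * Real.pi / ((k : ℂ) - 1)) * τ.im *
    mixedSum N v (j + 1) (k - 1 - j) τ)).mul
    (MvPolynomial.IsHomogeneous.pow (hlin (τ : ℂ)) j)).mul
    (MvPolynomial.IsHomogeneous.pow (hlin (conj (τ : ℂ))) (k - 2 - j))
  have e : 0 + 1 * j + 1 * (k - 2 - j) = k - 2 := by omega
  rwa [e] at h

/-! ### Polynomials determined by their values -/

/-- The restriction of a polynomial in `(X, Y)` to a parametrised curve. -/
noncomputable def restrict (a b : Polynomial ℂ) (P : Poly) : Polynomial ℂ :=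
  MvPolynomial.aeval ![a, b] P

theorem eval_restrict (a b : Polynomial ℂ) (P : Poly) (t : ℂ) :
    (restrict a b P).eval t = ev (a.eval t) (b.eval t) P := by
  rw [restrict, ev, MvPolynomial.aeval_def, ← MvPolynomial.coe_eval₂Hom, ← Polynomial.coe_evalRingHom,
    ← RingHom.comp_apply]
  congr 1
  refine MvPolynomial.ringHom_ext (fun r => by simp) (fun i => ?_)
  fin_cases i <;> simp

/-- The one-variable polynomial P(1, t) has infinitely many zeros, hence vanishes; homogeneity then
gives P = 0 wherever X ≠ 0. -/
theorem eq_zero_of_ev_one {n : ℕ} {P : Poly} (hP : P ∈ V n) {s : Set ℂ} (hs : s.Infinite)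
    (h : ∀ t ∈ s, ev 1 t P = 0) : P = 0 := by
  have h0 : restrict 1 Polynomial.X P = 0 :=
    Polynomial.eq_zero_of_infinite_isRoot _ (hs.mono fun t ht => by
      simpa [Polynomial.IsRoot, eval_restrict] using h t ht)
  have h1 : ∀ t, ev 1 t P = 0 := fun t => by
    simpa [h0] using (eval_restrict 1 Polynomial.X P t).symm
  refine MvPolynomial.funext_set (s := fun _ => {0}ᶜ) (fun _ => (Set.finite_singleton _).infinite_compl)
    fun x hx => ?_
  have hx0 : x 0 ≠ 0 := hx 0 (Set.mem_univ _)
  have e : MvPolynomial.eval x P = ev (x 0 * 1) (x 0 * (x 1 / x 0)) P := by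
    rw [ev, mul_one, mul_div_cancel₀ _ hx0]
    congr 2
    funext i
    fin_cases i <;> rfl
  rw [e, ev_smul hP, h1, mul_zero, map_zero]

theorem eval_eq_of_periodic {q : Polynomial ℂ} {a c : ℂ} (hc : c ≠ 0)
    (h : ∀ n : ℕ, q.eval (a + n * c) = q.eval a) (z : ℂ) : q.eval z = q.eval a := by
  have h0 : q - Polynomial.C (q.eval a) = 0 := by
    refine Polynomial.eq_zero_of_infinite_isRoot _
      ((Set.infinite_range_of_injective (f := fun n : ℕ => a + n * c) ?_).mono ?_)
    · intro m n hmn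
      simpa [hc] using hmn
    · rintro _ ⟨n, rfl⟩
      simp [Polynomial.IsRoot, h]
  rw [sub_eq_zero.1 h0]
  simp

theorem ev_T {N : ℕ} {P : Poly} (hP : ∀ γ ∈ CongruenceSubgroup.Gamma N, act P γ = P) (x y : ℂ) :
    ev (x + N * y) y P = ev x y P := by
  have h := congrArg (ev x y) (hP _ (T_zpow_mem_Gamma N 1))
  rw [ev_act] at h
  simp only [ModularGroup.coe_T_zpow] at h
  simpa using h

theorem ev_lower {N : ℕ} {P : Poly} (hP : ∀ γ ∈ CongruenceSubgroup.Gamma N, act P γ = P)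
    (x y : ℂ) : ev x (N * x + y) P = ev x y P := by
  let γ : SL(2, ℤ) := ⟨!![1, 0; N, 1], by simp [Matrix.det_fin_two]⟩
  have hγ : γ ∈ CongruenceSubgroup.Gamma N := by
    rw [CongruenceSubgroup.Gamma_mem]
    simp [γ]
  have h := congrArg (ev x y) (hP _ hγ)
  rw [ev_act] at h
  simpa [γ] using h

/-- Invariance under the two elementary unipotents makes P(x, 1) and P(1, y) periodic polynomials,
hence constants, equal because they agree at (1, 1). Comparing P(2, 1) with 2^n P(1, 1/2) shows that
this constant is 0 when n ≥ 1. -/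
theorem eq_zero_of_invariant {N : ℕ} [NeZero N] {n : ℕ} (hn : 1 ≤ n) {P : Poly} (hP : P ∈ V n)
    (h : ∀ γ ∈ CongruenceSubgroup.Gamma N, act P γ = P) : P = 0 := by
  have hN : (N : ℂ) ≠ 0 := NeZero.ne _
  have h1 : ∀ x, ev x 1 P = ev 0 1 P := by
    intro x
    have := eval_eq_of_periodic (q := restrict Polynomial.X 1 P) (a := 0) hN (fun m => ?_) x
    · simpa [eval_restrict] using this
    · induction m with
      | zero => simp
      | succ m ih =>
        rw [← ih, eval_restrict, eval_restrict]
        have := ev_T h (0 + m * N) 1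
        simp only [Polynomial.eval_X, Polynomial.eval_one]
        rw [← this]
        push_cast
        ring_nf
  have h2 : ∀ y, ev 1 y P = ev 1 0 P := by
    intro y
    have := eval_eq_of_periodic (q := restrict 1 Polynomial.X P) (a := 0) hN (fun m => ?_) y
    · simpa [eval_restrict] using this
    · induction m with
      | zero => simp
      | succ m ih =>
        rw [← ih, eval_restrict, eval_restrict]
        have := ev_lower h 1 (0 + m * N)
        simp only [Polynomial.eval_X, Polynomial.eval_one]
        rw [← this]
        push_cast
        ring_nf
  have h3 : ev 2 1 P = 2 ^ n * ev 1 (1 / 2) P := by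
    rw [← ev_smul hP]
    norm_num
  have h4 : ev 1 0 P = ev 0 1 P := by rw [← h2 1, h1 1]
  rw [h1, h2, h4] at h3
  have h5 : ev 0 1 P = 0 := by
    have h6 : (1 - 2 ^ n : ℂ) * ev 0 1 P = 0 := by linear_combination h3
    refine (mul_eq_zero.1 h6).resolve_left fun h7 => ?_
    have h8 : (2 : ℕ) ^ n = 1 := by
      have : (2 : ℂ) ^ n = 1 := by linear_combination -h7
      exact_mod_cast this
    have := Nat.one_lt_two_pow (n := n) (by omega)
    omega
  exact eq_zero_of_ev_one hP Set.infinite_univ fun t _ => by rw [h2, h4, h5]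

/-! ### Primitives of the same form: uniqueness and constancy of differences. -/

theorem sub_eq_sub_of_hasDifferential {F₁ F₂ : ℍ → Poly} {ω : ℍ → ℂ → Poly}
    (h₁ : HasDifferential F₁ ω) (h₂ : HasDifferential F₂ ω) (τ σ : ℍ) :
    F₁ τ - F₂ τ = F₁ σ - F₂ σ := by
  ext m
  have h : ∀ z : ℂ, 0 < z.im → HasFDerivAt
      (fun z => (F₁ (ofComplex z)).coeff m - (F₂ (ofComplex z)).coeff m) (0 : ℂ →L[ℝ] ℂ) z := by
    intro z hz
    obtain ⟨L₁, e₁, d₁⟩ := h₁ ⟨z, hz⟩ m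
    obtain ⟨L₂, e₂, d₂⟩ := h₂ ⟨z, hz⟩ m
    refine (d₁.sub d₂).congr_fderiv ?_
    ext w
    simp [e₁, e₂]
  simpa [MvPolynomial.coeff_sub] using eq_of_hasFDerivAt_zero h τ.im_pos σ.im_pos

theorem act_sub (P Q : Poly) (γ : SL(2, ℤ)) : act (P - Q) γ = act P γ - act Q γ := by
  simp [act]

theorem IsEquivariant.unique {N : ℕ} [NeZero N] {n : ℕ} (hn : 1 ≤ n) {F₁ F₂ : ℍ → Poly}
    {ω : ℍ → ℂ → Poly} (hV₁ : ∀ τ, F₁ τ ∈ V n) (hV₂ : ∀ τ, F₂ τ ∈ V n)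
    (he₁ : IsEquivariant N F₁) (he₂ : IsEquivariant N F₂) (h₁ : HasDifferential F₁ ω)
    (h₂ : HasDifferential F₂ ω) : F₁ = F₂ := by
  funext τ
  refine sub_eq_zero.1 (eq_zero_of_invariant (N := N) hn (Submodule.sub_mem _ (hV₁ τ) (hV₂ τ)) fun γ hγ => ?_)
  rw [sub_eq_sub_of_hasDifferential h₁ h₂ τ (γ • τ), act_sub, he₁ γ hγ, he₂ γ hγ,
    sub_eq_sub_of_hasDifferential h₁ h₂ (γ • τ) τ]

theorem infinite_irrational : {t : ℂ | ∃ s : ℝ, Irrational s ∧ (s : ℂ) = t}.Infinite := by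
  refine (Set.infinite_range_of_injective (f := fun n : ℕ => (((n : ℝ) + √2 : ℝ) : ℂ))
    fun m n h => by simpa using h).mono ?_
  rintro _ ⟨n, rfl⟩
  exact ⟨_, irrational_sqrt_two.natCast_add n, rfl⟩

/-- `calG` differs from the real analytic Eisenstein series by a constant polynomial. -/
theorem calG_sub_realEis_const {N : ℕ} [NeZero N] {k : ℕ} (hk : 3 ≤ k) (v : Fin 2 → ZMod N)
    (τ σ : ℍ) : calG N k v τ - realEis N k v τ = calG N k v σ - realEis N k v σ := by
  -- The differential of `realEis` is known only at generic points, and the points (1, t) with t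
  -- irrational are generic and numerous enough to determine a homogeneous polynomial.
  refine sub_eq_zero.1 (eq_zero_of_ev_one (n := k - 2)
    (Submodule.sub_mem _ (Submodule.sub_mem _ (calG_mem_V k v τ) (realEis_mem_V v τ))
      (Submodule.sub_mem _ (calG_mem_V k v σ) (realEis_mem_V v σ))) infinite_irrational ?_)
  rintro _ ⟨t, ht, rfl⟩
  have h : ∀ z : ℂ, 0 < z.im → HasFDerivAt (fun z => ev (1 : ℝ) t (calG N k v (ofComplex z)) -
      ev (1 : ℝ) t (realEis N k v (ofComplex z))) (0 : ℂ →L[ℝ] ℂ) z := by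
    intro z hz
    obtain ⟨L₁, e₁, d₁⟩ := hasFDerivAt_ev (hasDifferential_calG hk v) (calG_mem_V k v)
      (fun τ h => rePoly_mem_V (form_mem_V k _ τ h)) (1 : ℝ) t ⟨z, hz⟩
    obtain ⟨L₂, e₂, d₂⟩ := hasFDerivAt_ev_realEis hk v (isGeneric_one ht) ⟨z, hz⟩
    refine (d₁.sub d₂).congr_fderiv ?_
    ext w
    rw [sub_apply, e₁, e₂, ev_rePoly_real]
    simp [form]
  have := eq_of_hasFDerivAt_zero h τ.im_pos σ.im_pos
  simp only [ofComplex_apply, Complex.ofReal_one] at this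
  simp only [map_sub]
  rw [this, sub_self]

/-! ### Values at the point `(z, 1)` -/

/-- Both sides are the integral of (x - w)^n dw from 0 to z, the left one after binomial expansion.
-/
theorem sum_choose_div (n : ℕ) (x z : ℂ) :
    ∑ p ∈ Finset.range (n + 1), (n.choose p : ℂ) * (-1) ^ p * x ^ (n - p) * z ^ (p + 1) / (p + 1) =
      (x ^ (n + 1) - (x - z) ^ (n + 1)) / (n + 1) := by
  have hn : (n : ℂ) + 1 ≠ 0 := by exact_mod_cast n.succ_ne_zero
  have h0 : (x - z) ^ (n + 1) = ∑ p ∈ Finset.range (n + 1),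
      (-z) ^ (p + 1) * x ^ (n + 1 - (p + 1)) * (n + 1).choose (p + 1) + x ^ (n + 1) := by
    rw [sub_eq_neg_add x z, add_pow, Finset.sum_range_succ']
    simp
  rw [eq_div_iff hn, h0, Finset.sum_mul, sub_add_cancel_right, ← Finset.sum_neg_distrib]
  refine Finset.sum_congr rfl fun p _ => ?_
  have hp' : (p : ℂ) + 1 ≠ 0 := by exact_mod_cast p.succ_ne_zero
  have h : ((n : ℂ) + 1) * n.choose p = (n + 1).choose (p + 1) * (p + 1) := by
    exact_mod_cast Nat.add_one_mul_choose_eq n p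
  rw [div_mul_eq_mul_div, div_eq_iff hp', Nat.add_sub_add_right, neg_pow z]
  linear_combination (-1) ^ p * x ^ (n - p) * z ^ (p + 1) * h

/-- The part of the regularised integral of `f(w) (x - w)^n dw` which decays at the cusp. -/
noncomputable def tail (N n : ℕ) (f : ℍ → ℂ) (x z : ℂ) : ℂ :=
  verticalIntegral (fun w => (f (ofComplex w) - constTerm N f) * (x - w) ^ n) z

theorem tail_eq_sum {N : ℕ} [NeZero N] {k : ℕ} (hk : 3 ≤ k) (v : Fin 2 → ZMod N) (n : ℕ)
    (x : ℂ) {z : ℂ} (hz : 0 < z.im) :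
    tail N n (eisG N k v) x z = ∑ p ∈ Finset.range (n + 1), (n.choose p : ℂ) * (-1) ^ p *
      x ^ (n - p) * verticalIntegral
        (fun w => (eisG N k v (ofComplex w) - constTerm N (eisG N k v)) * w ^ p) z := by
  set a := constTerm N (eisG N k v)
  have hint : ∀ p : ℕ, IntegrableOn (fun t : ℝ =>
      (fun w => (eisG N k v (ofComplex w) - a) * w ^ p) (z + t * Complex.I)) (Set.Ioi 0) :=
    fun p => integrableOn_vertical
      (fun w hw => ((differentiableAt_eisG hk v hw).sub_const _).mul (differentiableAt_id.pow p))
      ((decaysOnStrips_eisG hk v).mul_pow p) hz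
  simp only [tail, verticalIntegral, ← integral_const_mul]
  rw [← integral_finsetSum _ fun p _ => ((hint p).mul_const Complex.I).const_mul _]
  congr 1
  funext t
  rw [sub_eq_neg_add x, add_pow, Finset.mul_sum, Finset.sum_mul]
  refine Finset.sum_congr rfl fun p _ => ?_
  rw [neg_pow]
  ring

theorem ev_regFormIntegral {N : ℕ} [NeZero N] {k : ℕ} (hk : 3 ≤ k) (v : Fin 2 → ZMod N) (x : ℂ)
    (τ : ℍ) :
    ev x 1 (regFormIntegral N k (eisG N k v) τ) = 2 * Real.pi * Complex.I *
      (tail N (k - 2) (eisG N k v) x τ -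
        constTerm N (eisG N k v) * (x ^ (k - 1) - (x - τ) ^ (k - 1)) / ((k : ℂ) - 1)) := by
  have h := sum_choose_div (k - 2) x τ
  have e : k - 2 + 1 = k - 1 := by omega
  have e' : ((k - 2 : ℕ) : ℂ) + 1 = (k : ℂ) - 1 := by
    rw [Nat.cast_sub (by omega)]; push_cast; ring
  rw [e, e'] at h
  rw [mul_div_assoc, ← h, tail_eq_sum hk v (k - 2) x τ.im_pos, e, regFormIntegral, map_sum, e,
    Finset.mul_sum, ← Finset.sum_sub_distrib, Finset.mul_sum]
  refine Finset.sum_congr rfl fun p _ => ?_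
  have hr := regIntegral_ofComplex N (eisG N k v) p τ.im_pos
  rw [ofComplex_apply] at hr
  simp only [map_mul, map_pow, ev_C, ev_X_zero, ev_X_one, one_pow, mul_one]
  rw [hr]
  ring

theorem conj_constTerm {N : ℕ} [NeZero N] {k : ℕ} (hk : 3 ≤ k) (v : Fin 2 → ZMod N) :
    conj (constTerm N (eisG N k v)) = constTerm N (eisG N k v) := by
  rw [constTerm_eisG hk v, Complex.conj_tsum]
  refine tsum_congr fun p => ?_
  split_ifs <;> simp

theorem sub_conj_eq (z : ℂ) : z - conj z = 2 * Complex.I * z.im := by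
  rw [Complex.sub_conj]
  push_cast
  ring

/-- The contributions a_0 τ^(k-1) cancel between the integral and its conjugate because a_0 is real.
Of the terms (x - τ)^(k-1), only the one at x = conj τ survives, giving a power of 2i Im τ. -/
theorem ev_calG {N : ℕ} [NeZero N] {k : ℕ} (hk : 3 ≤ k) (v : Fin 2 → ZMod N) (τ : ℍ) :
    ev τ 1 (calG N k v τ) = AG N k v - 2 * Real.pi / ((k : ℂ) - 1) * τ.im *
        (2 * Complex.I * τ.im) ^ (k - 2) * constTerm N (eisG N k v) -
      Real.pi * Complex.I * (tail N (k - 2) (eisG N k v) τ τ -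
        conj (tail N (k - 2) (eisG N k v) (conj (τ : ℂ)) τ)) := by
  have hk1 : (k : ℂ) - 1 ≠ 0 := by
    rw [sub_ne_zero]; exact_mod_cast (by omega : k ≠ 1)
  have h0 : (0 : ℂ) ^ (k - 1) = 0 := zero_pow (by omega)
  have e : k - 1 = k - 2 + 1 := by omega
  have h2 : conj (τ : ℂ) - τ = -(2 * Complex.I * τ.im) := by
    have := sub_conj_eq (τ : ℂ)
    rw [coe_im] at this
    linear_combination -this
  rw [calG, map_add, ev_rePoly, map_one, map_neg, map_neg, ev_regFormIntegral hk,
    ev_regFormIntegral hk, PG, map_mul, map_pow, ev_C, ev_X_one, sub_self, h0, h2]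
  simp only [map_neg, map_mul, map_sub, map_div₀, map_pow, conj_constTerm hk, Complex.conj_conj,
    Complex.conj_I, Complex.conj_ofReal, map_ofNat, map_natCast, map_one]
  rw [one_pow, mul_one, e, pow_succ (-(2 * -Complex.I * (τ.im : ℂ)))]
  rw [show -(2 * -Complex.I * (τ.im : ℂ)) = 2 * Complex.I * τ.im by ring]
  field_simp
  ring_nf
  simp only [Complex.I_sq]
  ring

/-- At (τ, 1) the form X - τY vanishes, so only j = 0 contributes. -/
theorem ev_realEis {N k : ℕ} (hk : 3 ≤ k) (v : Fin 2 → ZMod N) (τ : ℍ) :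
    ev τ 1 (realEis N k v τ) = -(2 * Real.pi / ((k : ℂ) - 1)) * τ.im *
      (2 * Complex.I * τ.im) ^ (k - 2) * mixedSum N v 1 (k - 1) τ := by
  have h2 := sub_conj_eq (τ : ℂ)
  rw [coe_im] at h2
  rw [realEis, map_sum, Finset.sum_eq_single 0]
  · simp only [map_mul, map_pow, map_sub, ev_C, ev_X_zero, ev_X_one, mul_one, pow_zero, h2,
      Nat.sub_zero, zero_add]
    ring
  · intro j _ hj
    simp only [map_mul, map_pow, map_sub, ev_C, ev_X_zero, ev_X_one, mul_one, sub_self,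
      zero_pow hj, mul_zero, zero_mul]
  · intro h
    exact absurd (Finset.mem_range.2 (by omega)) h

/-- The part of the value of the real analytic Eisenstein series at `(z, 1)` coming from the terms
with `m ≠ 0`. -/
noncomputable def bulk (N k : ℕ) (v : Fin 2 → ZMod N) (z : ℂ) : ℂ :=
  2 * Real.pi / ((k : ℂ) - 1) * z.im * (2 * Complex.I * z.im) ^ (k - 2) *
    (mixedSum N v 1 (k - 1) z - constTerm N (eisG N k v))

/-- The part of the value of `calG` at `(z, 1)` which decays at the cusp. -/
noncomputable def remainder (N k : ℕ) (v : Fin 2 → ZMod N) (z : ℂ) : ℂ :=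
  Real.pi * Complex.I * (tail N (k - 2) (eisG N k v) z z -
    conj (tail N (k - 2) (eisG N k v) (conj z) z))

theorem ev_calG_sub_realEis {N : ℕ} [NeZero N] {k : ℕ} (hk : 3 ≤ k) (v : Fin 2 → ZMod N) (τ : ℍ) :
    ev τ 1 (calG N k v τ - realEis N k v τ) =
      AG N k v + bulk N k v τ - remainder N k v τ := by
  rw [map_sub, ev_calG hk, ev_realEis hk, bulk, remainder, coe_im]
  ring

theorem eisG_ofComplex_add {N : ℕ} (k : ℕ) (v : Fin 2 → ZMod N) (z : ℂ) :
    eisG N k v (ofComplex (z + N)) = eisG N k v (ofComplex z) := by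
  simpa using periodic_eisG k v z

theorem tail_add {N : ℕ} (k n : ℕ) (v : Fin 2 → ZMod N) (x z : ℂ) :
    tail N n (eisG N k v) (x + N) (z + N) = tail N n (eisG N k v) x z := by
  simp only [tail, verticalIntegral]
  congr 1
  funext t
  rw [add_right_comm, eisG_ofComplex_add, add_sub_add_right_eq_sub]

theorem remainder_add {N : ℕ} (k : ℕ) (v : Fin 2 → ZMod N) (z : ℂ) :
    remainder N k v (z + N) = remainder N k v z := by
  simp only [remainder, map_add, map_natCast, tail_add]

theorem mixedSum_add {N : ℕ} (v : Fin 2 → ZMod N) (r s : ℕ) {z : ℂ} (hz : 0 < z.im) :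
    mixedSum N v r s (z + N) = mixedSum N v r s z := by
  have h := mixedSum_smul v r s (T_zpow_mem_Gamma N 1) ⟨z, hz⟩
  rw [den_T_zpow, modular_T_zpow_smul, coe_vadd] at h
  simpa [add_comm] using h

theorem bulk_add {N : ℕ} (k : ℕ) (v : Fin 2 → ZMod N) {z : ℂ} (hz : 0 < z.im) :
    bulk N k v (z + N) = bulk N k v z := by
  simp only [bulk, mixedSum_add v _ _ hz, Complex.add_im, Complex.natCast_im, add_zero]

/-- The value at `(z, 1)` of the constant polynomial `calG - realEis` does not depend on `z`. -/
theorem exists_const_eq_bulk_sub_remainder {N : ℕ} [NeZero N] {k : ℕ} (hk : 3 ≤ k)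
    (v : Fin 2 → ZMod N) (τ₀ : ℍ) :
    ∃ κ : ℂ, (∀ x : ℂ, ev x 1 (calG N k v τ₀ - realEis N k v τ₀) = κ) ∧
      ∀ z : ℂ, 0 < z.im → AG N k v + bulk N k v z - remainder N k v z = κ := by
  set K := calG N k v τ₀ - realEis N k v τ₀
  have h1 : ∀ z : ℂ, 0 < z.im → ev z 1 K = AG N k v + bulk N k v z - remainder N k v z := by
    intro z hz
    have := ev_calG_sub_realEis hk v ⟨z, hz⟩
    rwa [calG_sub_realEis_const hk v _ τ₀] at this
  have hN : (N : ℂ) ≠ 0 := NeZero.ne _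
  -- K(x, 1) is a polynomial in x taking the same value at all points i + mN, since `bulk` and
  -- `remainder` have period N.
  have h2 : ∀ x, ev x 1 K = ev Complex.I 1 K := by
    intro x
    have := eval_eq_of_periodic (q := restrict Polynomial.X 1 K) (a := Complex.I) hN
      (fun m => ?_) x
    · simpa [eval_restrict] using this
    · simp only [eval_restrict, Polynomial.eval_X, Polynomial.eval_one]
      induction m with
      | zero => simp
      | succ m ih =>
        have hI : 0 < (Complex.I + m * (N : ℂ)).im := by simp
        have hI' : 0 < (Complex.I + m * (N : ℂ) + N).im := by simp
        rw [← ih, h1 _ hI, ← bulk_add k v hI, ← remainder_add k v, ← h1 _ hI']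
        push_cast
        ring_nf
  exact ⟨ev Complex.I 1 K, h2, fun z hz => by rw [← h1 z hz, h2]⟩

/-! ### Decay of the remainder -/

/-- The hypothesis on x - z covers the two cases needed, x = z and x = conj z. Along the path |x -
w| ≤ 2 Im w, so half of the exponential rate absorbs the power and the other half gives the bound.
-/
theorem exists_norm_tail_le {N : ℕ} [NeZero N] {k : ℕ} (hk : 3 ≤ k) (v : Fin 2 → ZMod N) (n : ℕ) :
    ∃ D c : ℝ, 0 < c ∧ ∀ x z : ℂ, 1 ≤ z.im → ‖x - z‖ ≤ 2 * z.im →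
      ‖tail N n (eisG N k v) x z‖ ≤ D * Real.exp (-c * z.im) := by
  obtain ⟨C, c, hc, h⟩ := exists_decay_eisG hk v one_pos
  set B : ℝ := n.factorial / (c / 4) ^ n
  refine ⟨∫ t in Set.Ioi (0 : ℝ), C * B * Real.exp (-(c / 2) * t), c / 2, half_pos hc,
    fun x z hz hx => ?_⟩
  have hy : 0 < z.im := by linarith
  rw [← integral_mul_const]
  refine norm_integral_le_of_norm_le
    (((exp_neg_integrableOn_Ioi 0 (half_pos hc)).const_mul _).mul_const _)
    ((ae_restrict_mem measurableSet_Ioi).mono fun t ht => ?_)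
  have ht' : 0 < t := ht
  have hw : 0 < (z + t * Complex.I).im := by rw [add_mul_I_im]; positivity
  have h1 := h ⟨_, hw⟩ (by
    have : (⟨_, hw⟩ : ℍ).im = z.im + t := add_mul_I_im z t
    rw [this]; linarith)
  have e : (⟨_, hw⟩ : ℍ).im = z.im + t := add_mul_I_im z t
  rw [e] at h1
  have h2 : ‖x - (z + t * Complex.I)‖ ≤ 2 * (z.im + t) := by
    calc ‖x - (z + t * Complex.I)‖ = ‖(x - z) - t * Complex.I‖ := by ring_nf
      _ ≤ ‖x - z‖ + ‖(t : ℂ) * Complex.I‖ := norm_sub_le _ _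
      _ = ‖x - z‖ + t := by simp [abs_of_pos ht']
      _ ≤ _ := by linarith
  rw [norm_mul, norm_mul, norm_pow, Complex.norm_I, mul_one, ofComplex_apply_of_im_pos hw]
  calc _ ≤ C * Real.exp (-c * (z.im + t)) * (2 * (z.im + t)) ^ n := by
        gcongr
        exact (norm_nonneg _).trans h1
    _ ≤ C * Real.exp (-c * (z.im + t)) * (B * Real.exp (c / 4 * (2 * (z.im + t)))) := by
        refine mul_le_mul_of_nonneg_left ?_ ((norm_nonneg _).trans h1)
        exact pow_le_mul_exp n (by positivity) (by positivity)
    _ = C * B * (Real.exp (-c * (z.im + t)) * Real.exp (c / 4 * (2 * (z.im + t)))) := by ring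
    _ = C * B * (Real.exp (-(c / 2) * t) * Real.exp (-(c / 2) * z.im)) := by
        rw [← Real.exp_add, ← Real.exp_add]; ring_nf
    _ = _ := by ring

theorem exists_norm_remainder_le {N : ℕ} [NeZero N] {k : ℕ} (hk : 3 ≤ k) (v : Fin 2 → ZMod N) :
    ∃ D c : ℝ, 0 < c ∧ ∀ z : ℂ, 1 ≤ z.im →
      ‖remainder N k v z‖ ≤ D * Real.exp (-c * z.im) := by
  obtain ⟨D, c, hc, h⟩ := exists_norm_tail_le hk v (k - 2)
  refine ⟨Real.pi * (D + D), c, hc, fun z hz => ?_⟩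
  have h1 := h z z hz (by rw [sub_self, norm_zero]; linarith)
  have h2 := h (conj z) z hz (by
    rw [← norm_neg, neg_sub, sub_conj_eq]
    simp [abs_of_nonneg (by linarith : 0 ≤ z.im)])
  rw [remainder, norm_mul, norm_mul, Complex.norm_I, mul_one, Complex.norm_real,
    Real.norm_of_nonneg Real.pi_pos.le, mul_assoc, add_mul]
  gcongr
  refine (norm_sub_le _ _).trans (add_le_add h1 ?_)
  rwa [RCLike.norm_conj]

/-! ### A rational integral over the real line -/

theorem ofReal_sub_mul_I_ne_zero {b : ℝ} (hb : b ≠ 0) (x : ℝ) : (x : ℂ) - b * Complex.I ≠ 0 := by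
  intro h
  exact hb (by simpa using congrArg Complex.im h)

theorem ofReal_add_mul_I_ne_zero {b : ℝ} (hb : b ≠ 0) (x : ℝ) : (x : ℂ) + b * Complex.I ≠ 0 := by
  intro h
  exact hb (by simpa using congrArg Complex.im h)

theorem norm_sub_mul_I_sq (b x : ℝ) : ‖(x : ℂ) - b * Complex.I‖ ^ 2 = x ^ 2 + b ^ 2 := by
  rw [← Complex.normSq_eq_norm_sq, Complex.normSq_apply]
  simp
  ring

theorem norm_add_mul_I (b x : ℝ) : ‖(x : ℂ) + b * Complex.I‖ = ‖(x : ℂ) - b * Complex.I‖ := by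
  rw [← RCLike.norm_conj]
  simp [sub_eq_add_neg]

theorem inv_sq_add_sq_eq {b : ℝ} (hb : b ≠ 0) (x : ℝ) :
    (x ^ 2 + b ^ 2)⁻¹ = (b ^ 2)⁻¹ * (1 + (x / b) ^ 2)⁻¹ := by
  rw [← mul_inv]
  congr 1
  field_simp
  ring

theorem integrable_inv_sq_add_sq {b : ℝ} (hb : b ≠ 0) :
    Integrable fun x : ℝ => (x ^ 2 + b ^ 2)⁻¹ := by
  simp_rw [inv_sq_add_sq_eq hb]
  exact (integrable_inv_one_add_sq.comp_div hb).const_mul _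

theorem integral_inv_sq_add_sq {b : ℝ} (hb : b ≠ 0) :
    ∫ x : ℝ, (x ^ 2 + b ^ 2)⁻¹ = Real.pi / |b| := by
  simp_rw [inv_sq_add_sq_eq hb]
  rw [integral_const_mul, Measure.integral_comp_div (fun u : ℝ => (1 + u ^ 2)⁻¹) b,
    integral_univ_inv_one_add_sq, smul_eq_mul, ← sq_abs]
  have : |b| ≠ 0 := abs_ne_zero.2 hb
  field_simp

theorem integrable_of_norm_eq_pow {b : ℝ} (hb : b ≠ 0) {f : ℝ → ℂ} (hf : Continuous f) (n : ℕ)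
    (h : ∀ x, ‖f x‖ = (‖(x : ℂ) - b * Complex.I‖ ^ (n + 2))⁻¹) : Integrable f := by
  refine ((integrable_inv_sq_add_sq hb).const_mul (|b| ^ n)⁻¹).mono' hf.aestronglyMeasurable
    (.of_forall fun x => ?_)
  rw [h, pow_add, mul_inv, norm_sub_mul_I_sq]
  have hb' : 0 < |b| := abs_pos.2 hb
  gcongr
  simpa using Complex.abs_im_le_norm ((x : ℂ) - b * Complex.I)

/-- The function `1 / ((x + ib) (x - ib)^j)`. -/
noncomputable def ratFun (b : ℝ) (j : ℕ) (x : ℝ) : ℂ :=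
  1 / (((x : ℂ) + b * Complex.I) * ((x : ℂ) - b * Complex.I) ^ j)

theorem continuous_ratFun {b : ℝ} (hb : b ≠ 0) (j : ℕ) : Continuous (ratFun b j) := by
  refine continuous_const.div (by fun_prop) fun x => ?_
  exact mul_ne_zero (ofReal_add_mul_I_ne_zero hb x) (pow_ne_zero _ (ofReal_sub_mul_I_ne_zero hb x))

theorem integrable_ratFun {b : ℝ} (hb : b ≠ 0) (j : ℕ) : Integrable (ratFun b (j + 1)) := by
  refine integrable_of_norm_eq_pow hb (continuous_ratFun hb _) j fun x => ?_
  rw [ratFun, norm_div, norm_mul, norm_pow, norm_add_mul_I, norm_one, one_div]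
  congr 1
  ring

theorem integrable_inv_pow {b : ℝ} (hb : b ≠ 0) (j : ℕ) :
    Integrable fun x : ℝ => 1 / ((x : ℂ) - b * Complex.I) ^ (j + 2) := by
  refine integrable_of_norm_eq_pow hb (continuous_const.div (by fun_prop) fun x =>
    pow_ne_zero _ (ofReal_sub_mul_I_ne_zero hb x)) j fun x => ?_
  rw [norm_div, norm_pow, norm_one, one_div]

theorem integral_inv_pow {b : ℝ} (hb : b ≠ 0) (j : ℕ) :
    ∫ x : ℝ, 1 / ((x : ℂ) - b * Complex.I) ^ (j + 2) = 0 := by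
  have hj : (j : ℂ) + 1 ≠ 0 := by exact_mod_cast j.succ_ne_zero
  have hd : ∀ x : ℝ, HasDerivAt (fun x : ℝ =>
      -(1 / ((j : ℂ) + 1)) * (((x : ℂ) - b * Complex.I) ^ (j + 1))⁻¹)
      (1 / ((x : ℂ) - b * Complex.I) ^ (j + 2)) x := by
    intro x
    have h0 := ofReal_sub_mul_I_ne_zero hb x
    have h1 : HasDerivAt (fun x : ℝ => (x : ℂ) - b * Complex.I) 1 x :=
      (hasDerivAt_id x).ofReal_comp.sub_const _
    refine (((h1.pow (j + 1)).inv (pow_ne_zero _ h0)).const_mul _).congr_deriv ?_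
    push_cast
    field_simp
    simp only [Pi.pow_apply]
    ring
  have hn : ∀ x : ℝ, ‖-(1 / ((j : ℂ) + 1)) * (((x : ℂ) - b * Complex.I) ^ (j + 1))⁻¹‖ ≤
      ‖(1 / ((j : ℂ) + 1))‖ * ((|x| ^ (j + 1))⁻¹) ∨ x = 0 := by
    intro x
    rcases eq_or_ne x 0 with hx | hx
    · exact Or.inr hx
    · left
      rw [norm_mul, norm_neg, norm_inv, norm_pow]
      have := abs_pos.2 hx
      gcongr
      simpa using Complex.abs_re_le_norm ((x : ℂ) - b * Complex.I)
  have hlim : ∀ l : Filter ℝ, Tendsto (fun x : ℝ => |x|) l atTop → (∀ᶠ x in l, x ≠ 0) →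
      Tendsto (fun x : ℝ => -(1 / ((j : ℂ) + 1)) * (((x : ℂ) - b * Complex.I) ^ (j + 1))⁻¹) l
        (𝓝 0) := by
    intro l hl hl0
    rw [tendsto_zero_iff_norm_tendsto_zero]
    refine squeeze_zero' (.of_forall fun _ => norm_nonneg _)
      (hl0.mono fun x hx => (hn x).resolve_right hx) ?_
    have := (((tendsto_pow_atTop j.succ_ne_zero).comp hl).inv_tendsto_atTop).const_mul
      ‖(1 / ((j : ℂ) + 1))‖
    simpa using! this
  simpa using integral_of_hasDerivAt_of_tendsto hd (integrable_inv_pow hb j)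
    (hlim atBot tendsto_abs_atBot_atTop (eventually_ne_atBot 0))
    (hlim atTop tendsto_abs_atTop_atTop (eventually_ne_atTop 0))

/-- Induction on j by partial fractions: each step brings out a factor i/(2b) and a pure power of x
- ib, which integrates to 0 because it has a primitive vanishing at both ends. -/
theorem integral_ratFun {b : ℝ} (hb : b ≠ 0) (j : ℕ) :
    ∫ x : ℝ, ratFun b (j + 1) x = (Complex.I / (2 * b)) ^ j * (Real.pi / |b| : ℝ) := by
  have hbc : (b : ℂ) ≠ 0 := by exact_mod_cast hb
  induction j with
  | zero =>
    rw [← integral_inv_sq_add_sq hb, ← integral_complex_ofReal, pow_zero, one_mul]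
    congr 1
    funext x
    rw [ratFun, one_div, zero_add, pow_one]
    push_cast
    congr 1
    linear_combination -(b : ℂ) ^ 2 * Complex.I_sq
  | succ j ih =>
    have e : ∀ x : ℝ, ratFun b (j + 1 + 1) x = Complex.I / (2 * b) * ratFun b (j + 1) x -
        Complex.I / (2 * b) * (1 / ((x : ℂ) - b * Complex.I) ^ (j + 2)) := by
      intro x
      have h1 := ofReal_add_mul_I_ne_zero hb x
      have h2 := ofReal_sub_mul_I_ne_zero hb x
      have hc : Complex.I / (2 * b) *
          (((x : ℂ) - b * Complex.I) - ((x : ℂ) + b * Complex.I)) = 1 := by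
        field_simp
        linear_combination -2 * (b : ℂ) * Complex.I_sq
      rw [ratFun, ratFun]
      generalize Complex.I / (2 * (b : ℂ)) = c at hc ⊢
      generalize (x : ℂ) - b * Complex.I = u at hc h2 ⊢
      generalize (x : ℂ) + b * Complex.I = w at hc h1 ⊢
      field_simp
      linear_combination -u ^ (j + 1) * hc
    simp_rw [e]
    rw [integral_sub ((integrable_ratFun hb j).const_mul _) ((integrable_inv_pow hb j).const_mul _),
      integral_const_mul, integral_const_mul, integral_inv_pow hb, ih]
    ring

/-! ### Unfolding -/

theorem hasSum_of_eq {ι : Type*} {f g : ι → ℂ} {a b : ℂ} (h : HasSum f a) (hfg : ∀ i, f i = g i)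
    (hab : a = b) : HasSum g b := by
  obtain rfl := funext hfg
  rwa [← hab]

theorem hasSum_intervalIntegral_mul {f : ℝ → ℂ} (hf : Integrable f) {T : ℝ} (hT : 0 < T) (a : ℝ) :
    HasSum (fun l : ℤ => ∫ x in (a + T * l)..(a + T * (l + 1)), f x) (∫ x, f x) := by
  have hT' := hT.ne'
  have h := (hf.comp_mul_left' hT').hasSum_intervalIntegral (a / T)
  have h2 := h.const_smul T
  rw [Measure.integral_comp_mul_left f T, abs_of_pos (inv_pos.2 hT), smul_smul,
    mul_inv_cancel₀ hT', one_smul] at h2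
  refine hasSum_of_eq h2 (fun l => ?_) rfl
  rw [intervalIntegral.integral_comp_mul_left f hT', smul_smul, mul_inv_cancel₀ hT', one_smul]
  congr 1
  · field_simp
  · field_simp
    ring

/-- The intervals of signed length mT starting at a + Tl cover the line m times, counted with
orientation. Induction on m adds or removes one tiling by intervals of length T. -/
theorem hasSum_intervalIntegral_zsmul {f : ℝ → ℂ} (hf : Integrable f) {T : ℝ} (hT : 0 < T)
    (a : ℝ) (m : ℤ) :
    HasSum (fun l : ℤ => ∫ x in (a + T * l)..(a + T * l + m * T), f x) (m * ∫ x, f x) := by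
  have hi : ∀ b c : ℝ, IntervalIntegrable f volume b c := fun b c => hf.intervalIntegrable
  have hadj : ∀ (m l : ℤ), (∫ x in (a + T * l)..(a + T * l + m * T), f x) +
      (∫ x in (a + T * (l + m : ℤ))..(a + T * ((l + m : ℤ) + 1)), f x) =
      ∫ x in (a + T * l)..(a + T * l + (m + 1 : ℤ) * T), f x := by
    intro m l
    have e1 : a + T * ((l + m : ℤ) : ℝ) = a + T * l + m * T := by push_cast; ring
    have e2 : a + T * (((l + m : ℤ) : ℝ) + 1) = a + T * l + (m + 1 : ℤ) * T := by push_cast; ring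
    rw [e2, e1]
    exact intervalIntegral.integral_add_adjacent_intervals (hi _ _) (hi _ _)
  have hshift : ∀ m : ℤ, HasSum (fun l : ℤ =>
      ∫ x in (a + T * (l + m : ℤ))..(a + T * ((l + m : ℤ) + 1)), f x) (∫ x, f x) := fun m =>
    (Equiv.addRight m).hasSum_iff.2 (hasSum_intervalIntegral_mul hf hT a)
  induction m using Int.induction_on with
  | zero => simp
  | succ i ih =>
    refine hasSum_of_eq (ih.add (hshift i)) (fun l => hadj i l) ?_
    push_cast
    ring
  | pred i ih =>
    refine hasSum_of_eq (ih.sub (hshift (-i - 1))) (fun l => ?_) ?_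
    · rw [sub_eq_iff_eq_add, hadj, sub_add_cancel]
    · push_cast
      ring

/-! ### The horizontal average of the real analytic Eisenstein series -/

open Classical in
/-- The terms of `mixedSum N v 1 (k - 1)` with `m ≠ 0`. -/
noncomputable def bulkTerm (k : ℕ) (p : Fin 2 → ℤ) (z : ℂ) : ℂ :=
  if p 0 = 0 then 0 else 1 / (lin p z ^ 1 * lin p (conj z) ^ (k - 1))

/-- For m = 0 the term of `mixedSum` is 1/n^k, and these terms add up to the constant term. -/
theorem hasSum_bulkTerm {N : ℕ} [NeZero N] {k : ℕ} (hk : 3 ≤ k) (v : Fin 2 → ZMod N) {z : ℂ}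
    (hz : 0 < z.im) : HasSum (fun p : LatIdx N v => bulkTerm k p.1 z)
      (mixedSum N v 1 (k - 1) z - constTerm N (eisG N k v)) := by
  have h1 := (summable_mixedSum hk v (show 1 + (k - 1) = k by omega) hz).hasSum
  have h2 : Summable fun p : LatIdx N v => if p.1 0 = 0 then 1 / (p.1 1 : ℂ) ^ k else 0 := by
    refine Summable.of_norm_bounded h1.summable.norm fun p => ?_
    split_ifs with h
    · simp [lin, h, ← pow_succ', show k - 1 + 1 = k by omega]
    · rw [norm_zero]
      exact norm_nonneg _
  rw [constTerm_eisG hk]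
  refine hasSum_of_eq (h1.sub h2.hasSum) (fun p => ?_) rfl
  rw [bulkTerm]
  split_ifs with h
  · simp [lin, h, ← pow_succ', show k - 1 + 1 = k by omega]
  · rw [sub_zero]

theorem bulkTerm_eq_ratFun {k : ℕ} {p : Fin 2 → ℤ} (hp : p 0 ≠ 0) (x y : ℝ) :
    bulkTerm k p (x + y * Complex.I) = ratFun (p 0 * y) (k - 1) (p 0 * x + p 1) := by
  rw [bulkTerm, if_neg hp, ratFun, pow_one]
  simp only [lin, map_add, map_mul, Complex.conj_ofReal, Complex.conj_I]
  push_cast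
  congr 2
  · ring
  · congr 1
    ring

theorem hasSum_intervalIntegral_bulkTerm {N : ℕ} [NeZero N] {k : ℕ} (hk : 3 ≤ k)
    (v : Fin 2 → ZMod N) {y : ℝ} (hy : 0 < y) :
    HasSum (fun p : LatIdx N v => ∫ x in (0 : ℝ)..N, bulkTerm k p.1 (x + y * Complex.I))
      (∫ x in (0 : ℝ)..N, (mixedSum N v 1 (k - 1) (x + y * Complex.I) -
        constTerm N (eisG N k v))) := by
  obtain ⟨u, hu, hub⟩ := exists_summable_bound hk N hy
  have him : ∀ x : ℝ, ((x : ℂ) + y * Complex.I).im = y := fun x => by simp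
  refine intervalIntegral.hasSum_integral_of_dominated_convergence (fun p _ => u p.1) (fun p => ?_)
    (fun p => .of_forall fun x hx => ?_) (.of_forall fun x _ => hu.subtype _)
    intervalIntegrable_const (.of_forall fun x _ => hasSum_bulkTerm hk v (by rw [him]; exact hy))
  · refine Continuous.aestronglyMeasurable ?_
    by_cases hp : p.1 0 = 0
    · simp only [bulkTerm, if_pos hp]
      exact continuous_const
    · simp_rw [bulkTerm_eq_ratFun hp]
      refine (continuous_ratFun ?_ _).comp (by fun_prop)
      exact mul_ne_zero (by exact_mod_cast hp) hy.ne'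
  · rw [Set.uIoc_of_le (Nat.cast_nonneg N)] at hx
    have hb := hub p.1 p.2.1 (x + y * Complex.I) (by simpa [abs_of_pos hx.1] using hx.2)
      (by rw [him])
    refine le_trans ?_ hb
    rw [bulkTerm]
    split_ifs
    · rw [norm_zero]; positivity
    · rw [norm_div, norm_mul, norm_pow, norm_pow, norm_lin_conj, ← pow_add, norm_one, one_div,
        show 1 + (k - 1) = k by omega]

open Classical in
/-- The sum of the `m`-th terms, unfolded to an integral over the real line. -/
theorem hasSum_unfold {N : ℕ} [NeZero N] {k : ℕ} (hk : 3 ≤ k) (d : ZMod N) {m : ℤ} (hm : m ≠ 0)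
    {y : ℝ} (hy : 0 < y) :
    HasSum (fun n : ℤ => if (n : ZMod N) = d then
        ∫ x in (0 : ℝ)..N, bulkTerm k ![m, n] (x + y * Complex.I) else 0)
      ((Complex.I / (2 * (m * y : ℝ))) ^ (k - 2) * (Real.pi / |m * y| : ℝ)) := by
  have hN : (0 : ℝ) < N := by exact_mod_cast NeZero.pos N
  have hm' : (m : ℝ) ≠ 0 := by exact_mod_cast hm
  have hb : (m * y : ℝ) ≠ 0 := mul_ne_zero hm' hy.ne'
  have e : k - 1 = k - 2 + 1 := by omega
  obtain ⟨d₀, rfl⟩ := ZMod.intCast_surjective d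
  let g : ℤ → ℤ := fun l => d₀ + N * l
  have hg : Function.Injective g := fun a b hab => by
    simpa [g, NeZero.ne N] using hab
  rw [← integral_ratFun hb, ← e, ← hg.hasSum_iff]
  -- Substituting u = mx + n gives a factor 1/m and intervals from n to n + mN. As n runs over its
  -- class mod N they cover the line m times, so the factors m cancel.
  · have h := (hasSum_intervalIntegral_zsmul (integrable_ratFun hb (k - 2)) hN d₀ m).mul_left
      ((m : ℂ)⁻¹)
    refine hasSum_of_eq h (fun l => ?_) ?_
    · have hgl : ((g l : ℤ) : ZMod N) = (d₀ : ZMod N) := by simp [g]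
      simp only [Function.comp_apply, hgl, if_true]
      have h1 : ∀ x : ℝ, bulkTerm k ![m, g l] (x + y * Complex.I) =
          ratFun (m * y) (k - 1) (m * x + g l) := fun x =>
        bulkTerm_eq_ratFun (p := ![m, g l]) hm x y
      simp_rw [h1]
      rw [intervalIntegral.integral_comp_mul_add (ratFun (m * y) (k - 1)) hm', ← e]
      rw [Complex.real_smul, Complex.ofReal_inv, Complex.ofReal_intCast]
      congr 2 <;> simp only [g] <;> push_cast <;> ring
    · have : (m : ℂ) ≠ 0 := by exact_mod_cast hm
      rw [← e, ← mul_assoc, inv_mul_cancel₀ this, one_mul]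
  · intro n hn
    rw [if_neg]
    intro h
    apply hn
    rw [eq_comm, ZMod.intCast_eq_intCast_iff_dvd_sub] at h
    obtain ⟨l, hl⟩ := h
    exact ⟨l, by simp only [g]; omega⟩

-- Summing over n first, with m fixed, reduces each nonzero m to an unfolded integral; the row m = 0
-- vanishes by the definition of `bulkTerm`.
open Classical in
theorem hasSum_average {N : ℕ} [NeZero N] {k : ℕ} (hk : 3 ≤ k) (v : Fin 2 → ZMod N) {y : ℝ}
    (hy : 0 < y) :
    HasSum (fun m : ℤ => if (m : ZMod N) = v 0 ∧ m ≠ 0 then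
        (Complex.I / (2 * (m * y : ℝ))) ^ (k - 2) * (Real.pi / |m * y| : ℝ) else 0)
      (∫ x in (0 : ℝ)..N, (mixedSum N v 1 (k - 1) (x + y * Complex.I) -
        constTerm N (eisG N k v))) := by
  set J : (Fin 2 → ℤ) → ℂ := fun p => ∫ x in (0 : ℝ)..N, bulkTerm k p (x + y * Complex.I)
  have h1 : HasSum (J ∘ (Subtype.val : LatIdx N v → Fin 2 → ℤ)) _ :=
    hasSum_intervalIntegral_bulkTerm hk v hy
  have h2 := (hasSum_subtype_iff_indicator
    (s := {p : Fin 2 → ℤ | p ≠ 0 ∧ ∀ i, (p i : ZMod N) = v i})).1 h1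
  rw [← (finTwoArrowEquiv ℤ).symm.hasSum_iff] at h2
  refine h2.prod_fiberwise fun m => ?_
  have hJ : ∀ n : ℤ, ((Set.indicator {p : Fin 2 → ℤ | p ≠ 0 ∧ ∀ i, (p i : ZMod N) = v i} J) ∘
      (finTwoArrowEquiv ℤ).symm) (m, n) =
      if (m : ZMod N) = v 0 ∧ m ≠ 0 then if (n : ZMod N) = v 1 then J ![m, n] else 0 else 0 := by
    intro n
    simp only [Function.comp_apply, finTwoArrowEquiv_symm_apply, Set.indicator_apply,
      Set.mem_ofPred_eq, Fin.forall_fin_two, Matrix.cons_val_zero, Matrix.cons_val_one]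
    rcases eq_or_ne m 0 with hm | hm
    · have : J ![m, n] = 0 := by simp [J, bulkTerm, hm]
      simp [this]
    · have : ![m, n] ≠ 0 := fun h => hm (congrFun h 0)
      simp only [ne_eq, this, not_false_eq_true, true_and, hm, and_true]
      split_ifs <;> tauto
  refine HasSum.congr_fun ?_ hJ
  split_ifs with hm
  · exact hasSum_unfold hk (v 1) hm.2 hy
  · exact hasSum_zero

open Classical in
/-- The sum of `1 / (|m| m^(k-2))` over the nonzero integers `m` congruent to `c`. -/
noncomputable def signedZeta (N k : ℕ) (c : ZMod N) : ℂ :=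
  ∑' m : ℤ, if (m : ZMod N) = c ∧ m ≠ 0 then 1 / ((|m| : ℤ) * (m : ℂ) ^ (k - 2)) else 0

/-- All powers of y cancel between the prefactor of `bulk` and the unfolded integrals, and
(2iy)(i/(2my)) = -1/m produces the sign. -/
theorem integral_bulk {N : ℕ} [NeZero N] {k : ℕ} (hk : 3 ≤ k) (v : Fin 2 → ZMod N) {y : ℝ}
    (hy : 0 < y) :
    ∫ x in (0 : ℝ)..N, bulk N k v (x + y * Complex.I) =
      2 * Real.pi ^ 2 / ((k : ℂ) - 1) * (-1) ^ k * signedZeta N k (v 0) := by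
  classical
  have hyc : (y : ℂ) ≠ 0 := by exact_mod_cast hy.ne'
  have him : ∀ x : ℝ, ((x : ℂ) + y * Complex.I).im = y := fun x => by simp
  simp only [bulk, him]
  rw [intervalIntegral.integral_const_mul, ← (hasSum_average hk v hy).tsum_eq, signedZeta,
    ← tsum_mul_left, ← tsum_mul_left]
  refine tsum_congr fun m => ?_
  split_ifs with hm
  · have hm0 : (m : ℂ) ≠ 0 := by exact_mod_cast hm.2
    have hm1 : ((|m| : ℤ) : ℂ) ≠ 0 := by
      rw [Int.cast_ne_zero]; exact abs_ne_zero.2 hm.2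
    have e1 : ((Real.pi / |m * y| : ℝ) : ℂ) = Real.pi / (((|m| : ℤ) : ℂ) * y) := by
      rw [abs_mul, abs_of_pos hy, ← Int.cast_abs, Complex.ofReal_div, Complex.ofReal_mul,
        Complex.ofReal_intCast]
    have e2 : (2 * Complex.I * (y : ℂ)) ^ (k - 2) * (Complex.I / (2 * (m * y : ℝ))) ^ (k - 2) =
        (-1) ^ k * (1 / (m : ℂ) ^ (k - 2)) := by
      have e3 : (-1 : ℂ) ^ k = (-1) ^ (k - 2) := by
        conv_lhs => rw [show k = k - 2 + 2 by omega, pow_add]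
        norm_num
      rw [e3, ← mul_pow, one_div, ← inv_pow, ← mul_pow]
      congr 1
      push_cast
      field_simp
      rw [Complex.I_sq]
    rw [e1]
    calc _ = 2 * Real.pi / ((k : ℂ) - 1) * y * (Real.pi / (((|m| : ℤ) : ℂ) * y)) *
        ((2 * Complex.I * (y : ℂ)) ^ (k - 2) * (Complex.I / (2 * (m * y : ℝ))) ^ (k - 2)) := by ring
      _ = _ := by
        rw [e2]
        field_simp
  · simp

/-! ### The constant `A_{G_k^v}` -/

theorem stdAddChar_eq_exp {N : ℕ} [NeZero N] (t : ZMod N) :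
    ZMod.stdAddChar t = Complex.exp (((2 * Real.pi * t.val / N : ℝ) : ℂ) * Complex.I) := by
  have h := ZMod.stdAddChar_coe (N := N) (t.val : ℤ)
  rw [Int.cast_natCast, ZMod.natCast_zmod_val] at h
  rw [h]
  congr 1
  push_cast
  ring

theorem ofReal_cos_eq {N : ℕ} [NeZero N] (t : ZMod N) :
    ((Real.cos (2 * Real.pi * t.val / N) : ℝ) : ℂ) =
      (ZMod.stdAddChar t + ZMod.stdAddChar (-t)) / 2 := by
  rw [AddChar.map_neg_eq_conj, Complex.add_conj, stdAddChar_eq_exp, Complex.exp_ofReal_mul_I_re]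
  push_cast
  ring

theorem ofReal_sin_eq {N : ℕ} [NeZero N] (t : ZMod N) :
    ((Real.sin (2 * Real.pi * t.val / N) : ℝ) : ℂ) =
      (ZMod.stdAddChar t - ZMod.stdAddChar (-t)) / (2 * Complex.I) := by
  rw [AddChar.map_neg_eq_conj, Complex.sub_conj, stdAddChar_eq_exp, Complex.exp_ofReal_mul_I_im]
  field_simp [Complex.I_ne_zero]
  push_cast
  ring

/-- The polylogarithm at a root of unity. -/
noncomputable def rootPolylog (N m : ℕ) [NeZero N] (b : ZMod N) : ℂ :=
  polylog m (ZMod.stdAddChar b)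

theorem rootPolylog_eq (N m : ℕ) [NeZero N] (b : ZMod N) :
    rootPolylog N m b =
      ∑' j : ℕ, ZMod.stdAddChar (b * ((j + 1 : ℕ) : ZMod N)) / ((j : ℂ) + 1) ^ m := by
  rw [rootPolylog, polylog]
  refine tsum_congr fun j => ?_
  rw [← AddChar.map_nsmul_eq_pow, nsmul_eq_mul, mul_comm]

theorem rootPolylog_neg (N m : ℕ) [NeZero N] (b : ZMod N) :
    rootPolylog N m (-b) = conj (rootPolylog N m b) := by
  rw [rootPolylog_eq, rootPolylog_eq, Complex.conj_tsum]
  refine tsum_congr fun j => ?_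
  rw [neg_mul, AddChar.map_neg_eq_conj, map_div₀, map_pow, map_add, map_one, Complex.conj_natCast]

theorem summable_inv_add_one_pow {m : ℕ} (hm : 2 ≤ m) :
    Summable fun j : ℕ => 1 / ((j : ℂ) + 1) ^ m := by
  have h := (summable_nat_add_iff 1).2 (Real.summable_one_div_nat_pow.2 (by omega : 1 < m))
  refine Summable.of_norm (h.congr fun j => ?_)
  rw [norm_div, norm_pow, norm_one, ← Nat.cast_add_one, Complex.norm_natCast]

theorem norm_stdAddChar {N : ℕ} [NeZero N] (t : ZMod N) : ‖ZMod.stdAddChar t‖ = 1 := by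
  rw [stdAddChar_eq_exp, Complex.norm_exp_ofReal_mul_I]

/-- The sum of `j^(-m)` over the positive integers `j` congruent to `c`. -/
noncomputable def partialZeta (N m : ℕ) (c : ZMod N) : ℂ :=
  ∑' j : ℕ, if ((j + 1 : ℕ) : ZMod N) = c then 1 / ((j : ℂ) + 1) ^ m else 0

theorem summable_partialZeta {N m : ℕ} (hm : 2 ≤ m) (c : ZMod N) :
    Summable fun j : ℕ => if ((j + 1 : ℕ) : ZMod N) = c then 1 / ((j : ℂ) + 1) ^ m else 0 := by
  refine Summable.of_norm_bounded (summable_inv_add_one_pow hm).norm fun j => ?_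
  split_ifs
  · rfl
  · rw [norm_zero]
    exact norm_nonneg _

/-- Orthogonality of additive characters, applied to each term of the polylogarithm series, selects
the j with j ≡ -c. -/
theorem sum_rootPolylog_mul {N m : ℕ} [NeZero N] (hm : 2 ≤ m) (c : ZMod N) :
    ∑ b : ZMod N, rootPolylog N m b * ZMod.stdAddChar (b * c) = N * partialZeta N m (-c) := by
  have hs : ∀ b : ZMod N, Summable fun j : ℕ =>
      ZMod.stdAddChar (b * ((j + 1 : ℕ) : ZMod N)) / ((j : ℂ) + 1) ^ m * ZMod.stdAddChar (b * c) := by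
    intro b
    refine Summable.of_norm_bounded (summable_inv_add_one_pow hm).norm fun j => ?_
    rw [norm_mul, norm_div, norm_stdAddChar, norm_stdAddChar, mul_one, norm_div, norm_one]
  simp_rw [rootPolylog_eq, ← tsum_mul_right]
  rw [← Summable.tsum_finsetSum fun b _ => hs b, partialZeta, ← tsum_mul_left]
  refine tsum_congr fun j => ?_
  have h := AddChar.sum_mulShift (((j + 1 : ℕ) : ZMod N) + c) (ZMod.isPrimitive_stdAddChar N)
  rw [ZMod.card] at h
  calc _ = (∑ b : ZMod N, ZMod.stdAddChar (b * (((j + 1 : ℕ) : ZMod N) + c))) /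
        ((j : ℂ) + 1) ^ m := by
        rw [Finset.sum_div]
        refine Finset.sum_congr rfl fun b _ => ?_
        rw [mul_add, AddChar.map_add_eq_mul]
        ring
    _ = _ := by
        rw [h]
        simp only [add_eq_zero_iff_eq_neg]
        split_ifs
        · ring
        · simp

theorem signedZeta_eq {N k : ℕ} (hk : 3 ≤ k) (c : ZMod N) :
    signedZeta N k c = partialZeta N (k - 1) c + (-1) ^ k * partialZeta N (k - 1) (-c) := by
  classical
  have hm : 2 ≤ k - 1 := by omega
  have e : k - 1 = k - 2 + 1 := by omega
  have hc : (-1 : ℂ) ^ k = (-1) ^ (k - 2) := by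
    conv_lhs => rw [show k = k - 2 + 2 by omega, pow_add]
    norm_num
  set f : ℤ → ℂ := fun m =>
    if (m : ZMod N) = c ∧ m ≠ 0 then 1 / ((|m| : ℤ) * (m : ℂ) ^ (k - 2)) else 0
  have h1 : ∀ j : ℕ, f (j + 1) =
      if ((j + 1 : ℕ) : ZMod N) = c then 1 / ((j : ℂ) + 1) ^ (k - 1) else 0 := by
    intro j
    have h0 : ((j : ℤ) + 1) ≠ 0 := by omega
    have ha : |(j : ℤ) + 1| = j + 1 := abs_of_nonneg (by omega)
    simp only [f, h0, ha, ne_eq, not_false_eq_true, and_true]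
    push_cast
    rw [e, pow_succ']
  have h2 : ∀ j : ℕ, f (-(j + 1)) = (-1) ^ k *
      if ((j + 1 : ℕ) : ZMod N) = -c then 1 / ((j : ℂ) + 1) ^ (k - 1) else 0 := by
    intro j
    have h0 : (-((j : ℤ) + 1)) ≠ 0 := by omega
    have ha : |-((j : ℤ) + 1)| = j + 1 := by rw [abs_neg]; exact abs_of_nonneg (by omega)
    have h3 : (((-((j : ℤ) + 1) : ℤ) : ZMod N) = c) ↔ (((j + 1 : ℕ) : ZMod N) = -c) := by
      rw [Int.cast_neg, neg_eq_iff_eq_neg]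
      push_cast
      rfl
    simp only [f, h0, ha, h3, ne_eq, not_false_eq_true, and_true]
    split_ifs
    · have h4 : ((-1 : ℂ) ^ (k - 2)) ≠ 0 := pow_ne_zero _ (by norm_num)
      have h5 : (-1 : ℂ) ^ (k - 2) * (-1) ^ (k - 2) = 1 := by
        rw [← mul_pow]
        norm_num
      have h6 : (j : ℂ) + 1 ≠ 0 := by exact_mod_cast j.succ_ne_zero
      rw [hc, e, pow_succ']
      push_cast
      rw [neg_pow ((j : ℂ) + 1)]
      field_simp
      linear_combination -h5
    · rw [mul_zero]
  have hs1 := summable_partialZeta hm c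
  have hs2 := (summable_partialZeta hm (-c)).mul_left ((-1 : ℂ) ^ k)
  have h := tsum_of_add_one_of_neg_add_one (f := f) (hs1.congr fun j => (h1 j).symm)
    (hs2.congr fun j => (h2 j).symm)
  have h0 : f 0 = 0 := by simp [f]
  rw [signedZeta, h, h0, add_zero, tsum_congr h1, tsum_congr h2, tsum_mul_left]
  rfl

theorem ofReal_clausen {N m : ℕ} [NeZero N] (b : ZMod N) :
    ((clausen m (2 * Real.pi * b.val / N) : ℝ) : ℂ) =
      if Odd m then (rootPolylog N m b + rootPolylog N m (-b)) / 2
        else (rootPolylog N m b - rootPolylog N m (-b)) / (2 * Complex.I) := by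
  have h : polylog m (Complex.exp (Complex.I * ((2 * Real.pi * b.val / N : ℝ) : ℂ))) =
      rootPolylog N m b := by
    rw [rootPolylog, stdAddChar_eq_exp, mul_comm Complex.I]
  rw [clausen, h, rootPolylog_neg, Complex.add_conj, Complex.sub_conj]
  split_ifs
  · push_cast
    ring
  · field_simp [Complex.I_ne_zero]
    push_cast
    ring

/-- Clausen values and cosines or sines are even or odd parts of polylogarithms and characters, with
matching parity. The product splits into four character sums, which pair up into the classes c and
-c. -/
theorem sum_clausen_mul {N k : ℕ} [NeZero N] (hk : 3 ≤ k) (c : ZMod N) :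
    ∑ b : ZMod N, ((clausen (k - 1) (2 * Real.pi * b.val / N) : ℝ) : ℂ) *
      ((if Even k then Real.cos (2 * Real.pi * (-(b * c)).val / N)
        else Real.sin (2 * Real.pi * (-(b * c)).val / N) : ℝ) : ℂ) =
      (-1) ^ k * N / 2 * signedZeta N k c := by
  have hm : 2 ≤ k - 1 := by omega
  have h1 := sum_rootPolylog_mul (N := N) hm c
  have h2 := sum_rootPolylog_mul (N := N) hm (-c)
  have h3 : ∑ b : ZMod N, rootPolylog N (k - 1) (-b) * ZMod.stdAddChar (b * c) =
      N * partialZeta N (k - 1) c := by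
    rw [← Equiv.sum_comp (Equiv.neg (ZMod N))]
    simpa using h2
  have h4 : ∑ b : ZMod N, rootPolylog N (k - 1) (-b) * ZMod.stdAddChar (b * -c) =
      N * partialZeta N (k - 1) (-c) := by
    rw [← Equiv.sum_comp (Equiv.neg (ZMod N))]
    simpa using h1
  rw [neg_neg] at h2
  rw [signedZeta_eq hk]
  rcases Nat.even_or_odd k with hk' | hk'
  · have ho : Odd (k - 1) := by
      obtain ⟨r, hr⟩ := hk'
      exact ⟨r - 1, by omega⟩
    simp only [if_pos hk', ofReal_cos_eq, ofReal_clausen, if_pos ho, hk'.neg_one_pow, neg_neg]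
    have e : ∀ b : ZMod N, (rootPolylog N (k - 1) b + rootPolylog N (k - 1) (-b)) / 2 *
        ((ZMod.stdAddChar (-(b * c)) + ZMod.stdAddChar (b * c)) / 2) =
        (rootPolylog N (k - 1) b * ZMod.stdAddChar (b * -c) +
        rootPolylog N (k - 1) b * ZMod.stdAddChar (b * c) +
        rootPolylog N (k - 1) (-b) * ZMod.stdAddChar (b * -c) +
        rootPolylog N (k - 1) (-b) * ZMod.stdAddChar (b * c)) / 4 := by
      intro b
      rw [mul_neg]
      ring
    simp_rw [e]
    rw [← Finset.sum_div, Finset.sum_add_distrib, Finset.sum_add_distrib, Finset.sum_add_distrib,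
      h1, h2, h3, h4]
    ring
  · have ho : ¬ Odd (k - 1) := by
      obtain ⟨r, hr⟩ := hk'
      rw [Nat.not_odd_iff_even]
      exact ⟨r, by omega⟩
    have hke : ¬ Even k := Nat.not_even_iff_odd.2 hk'
    simp only [if_neg hke, ofReal_sin_eq, ofReal_clausen, if_neg ho, hk'.neg_one_pow, neg_neg]
    have e : ∀ b : ZMod N, (rootPolylog N (k - 1) b - rootPolylog N (k - 1) (-b)) /
        (2 * Complex.I) *
        ((ZMod.stdAddChar (-(b * c)) - ZMod.stdAddChar (b * c)) / (2 * Complex.I)) =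
        (rootPolylog N (k - 1) b * ZMod.stdAddChar (b * c) -
        rootPolylog N (k - 1) b * ZMod.stdAddChar (b * -c) +
        rootPolylog N (k - 1) (-b) * ZMod.stdAddChar (b * -c) -
        rootPolylog N (k - 1) (-b) * ZMod.stdAddChar (b * c)) / 4 := by
      intro b
      rw [mul_neg, div_mul_div_comm, show 2 * Complex.I * (2 * Complex.I) = -4 by
        linear_combination 4 * Complex.I_sq]
      ring
    simp_rw [e]
    rw [← Finset.sum_div, Finset.sum_sub_distrib, Finset.sum_add_distrib, Finset.sum_sub_distrib,
      h1, h2, h3, h4]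
    ring

theorem ofReal_AG {N k : ℕ} [NeZero N] (hk : 3 ≤ k) (v : Fin 2 → ZMod N) :
    (AG N k v : ℂ) =
      -(2 * Real.pi ^ 2 / (((k : ℂ) - 1) * N)) * (-1) ^ k * signedZeta N k (v 0) := by
  have hN : (N : ℂ) ≠ 0 := NeZero.ne _
  have hk1 : (k : ℂ) - 1 ≠ 0 := by
    rw [sub_ne_zero]; exact_mod_cast (by omega : k ≠ 1)
  have hpi : (Real.pi : ℂ) ≠ 0 := by exact_mod_cast Real.pi_ne_zero
  set s : ℂ := (-1) ^ (k - 1 + (k + 1) / 2)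
  set q : ℂ := ((k - 2).factorial : ℂ) / (2 * Real.pi) ^ (k - 2)
  have hsum : (((∑ u : Fin 2 → ZMod N, Axi N k u *
      (if Even k then Real.cos (2 * Real.pi * (pairing u v).val / N)
        else Real.sin (2 * Real.pi * (pairing u v).val / N)) : ℝ)) : ℂ) =
      s * q * ((-1) ^ k * N / 2 * signedZeta N k (v 0)) := by
    -- Only u = (0, b) contributes, and there the pairing is -bc, with c the first entry of v.
    rw [← sum_clausen_mul hk (v 0), Finset.mul_sum, ← (finTwoArrowEquiv (ZMod N)).symm.sum_comp,
      Fintype.sum_prod_type, Finset.sum_eq_single 0]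
    · rw [Complex.ofReal_sum]
      refine Finset.sum_congr rfl fun b _ => ?_
      simp only [finTwoArrowEquiv_symm_apply, Axi, pairing, Matrix.cons_val_zero,
        Matrix.cons_val_one, if_true, zero_mul, zero_sub]
      rw [Complex.ofReal_mul, Complex.ofReal_mul, ← mul_assoc]
      congr 2
      simp only [s, q]
      push_cast
      ring
    · intro a _ ha
      refine Finset.sum_eq_zero fun b _ => ?_
      simp [Axi, ha]
    · intro h
      exact absurd (Finset.mem_univ _) h
  -- The exponents add up to ⌊k/2⌋ + (k - 1) + ⌈k/2⌉ = 2k - 1.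
  have hsign : (-1 : ℂ) ^ (k / 2) * s = -1 := by
    simp only [s]
    rw [← pow_add]
    refine Odd.neg_one_pow ⟨k - 1, by omega⟩
  have hfac : ((k - 1).factorial : ℂ) = ((k : ℂ) - 1) * (k - 2).factorial := by
    have : (k - 1).factorial = (k - 1) * (k - 2).factorial := by
      obtain ⟨n, rfl⟩ : ∃ n, k = n + 2 := ⟨k - 2, by omega⟩
      exact Nat.factorial_succ n
    rw [this, Nat.cast_mul, Nat.cast_sub (by omega), Nat.cast_one]
  have hf0 : ((k - 2).factorial : ℂ) ≠ 0 := by exact_mod_cast Nat.factorial_ne_zero _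
  have hpow : (2 * (Real.pi : ℂ)) ^ k = (2 * Real.pi) ^ (k - 2) * (2 * Real.pi) ^ 2 := by
    rw [← pow_add]
    congr 1
    omega
  rw [AG, Complex.ofReal_mul, hsum]
  push_cast
  rw [hfac, hpow]
  calc _ = ((-1 : ℂ) ^ (k / 2) * s) * ((2 * Real.pi) ^ (k - 2) * (2 * Real.pi) ^ 2 /
        ((N : ℂ) ^ 2 * (((k : ℂ) - 1) * (k - 2).factorial)) * q *
          ((-1) ^ k * N / 2 * signedZeta N k (v 0))) := by ring
    _ = _ := by
        rw [hsign]
        simp only [q]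
        field_simp

/-! ### Comparison of `calG` with the real analytic Eisenstein series -/

theorem intervalIntegrable_bulk {N : ℕ} [NeZero N] {k : ℕ} (hk : 3 ≤ k) (v : Fin 2 → ZMod N)
    {y : ℝ} (hy : 0 < y) :
    IntervalIntegrable (fun x : ℝ => bulk N k v (x + y * Complex.I)) volume 0 N := by
  obtain ⟨u, hu, hub⟩ := exists_summable_bound hk N hy
  have him : ∀ x : ℝ, ((x : ℂ) + y * Complex.I).im = y := fun x => by simp
  have him' : ∀ x : ℝ, 0 < ((x : ℂ) + y * Complex.I).im := fun x => by rw [him]; exact hy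
  have hc : ContinuousOn (fun x : ℝ => mixedSum N v 1 (k - 1) (x + y * Complex.I))
      (Set.uIcc 0 N) := by
    refine continuousOn_tsum (u := fun p : LatIdx N v => u p.1) (fun p => ?_) (hu.subtype _)
      (fun p x hx => ?_)
    · have hl : Continuous fun z : ℂ => lin p.1 z :=
        continuous_iff_continuousAt.2 fun z => (hasDerivAt_lin p.1 z).continuousAt
      refine (continuous_const.div (by fun_prop) fun x => ?_).continuousOn
      have h0 := lin_ne_zero p.2.1 (him' x)
      rw [lin_conj]
      exact mul_ne_zero (pow_ne_zero _ h0) (pow_ne_zero _ ((map_ne_zero _).2 h0))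
    · rw [Set.uIcc_of_le (Nat.cast_nonneg N)] at hx
      refine le_of_eq_of_le ?_ (hub p.1 p.2.1 (x + y * Complex.I)
        (by simpa [abs_of_nonneg hx.1] using hx.2) (by rw [him]))
      rw [norm_div, norm_mul, norm_pow, norm_pow, norm_lin_conj, ← pow_add, norm_one, one_div,
        show 1 + (k - 1) = k by omega]
  simp only [bulk, him]
  exact ((hc.sub continuousOn_const).intervalIntegrable).const_mul _

theorem integral_bulk_eq_neg {N : ℕ} [NeZero N] {k : ℕ} (hk : 3 ≤ k) (v : Fin 2 → ZMod N)
    {y : ℝ} (hy : 0 < y) :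
    ∫ x in (0 : ℝ)..N, bulk N k v (x + y * Complex.I) = -(N * AG N k v) := by
  have hN : (N : ℂ) ≠ 0 := NeZero.ne _
  have hk1 : (k : ℂ) - 1 ≠ 0 := by
    rw [sub_ne_zero]; exact_mod_cast (by omega : k ≠ 1)
  rw [integral_bulk hk v hy, ofReal_AG hk v]
  field_simp

/-- Integrating A + bulk - remainder = κ over a period at height y cancels A against `bulk`, so Nκ
is minus the integral of `remainder`, which tends to 0 as y grows. -/
theorem calG_eq_realEis {N : ℕ} [NeZero N] {k : ℕ} (hk : 3 ≤ k) (v : Fin 2 → ZMod N) :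
    calG N k v = realEis N k v := by
  funext τ
  obtain ⟨κ, hκ, h⟩ := exists_const_eq_bulk_sub_remainder hk v τ
  obtain ⟨D, c, hc, hR⟩ := exists_norm_remainder_le hk v
  have hN : (N : ℂ) ≠ 0 := NeZero.ne _
  have him : ∀ x y : ℝ, ((x : ℂ) + y * Complex.I).im = y := fun x y => by simp
  have hbound : ∀ y : ℝ, 1 ≤ y → ‖-(N * κ)‖ ≤ D * Real.exp (-c * y) * |(N : ℝ) - 0| := by
    intro y hy
    have hy0 : 0 < y := by linarith
    have hint : ∫ x in (0 : ℝ)..N, remainder N k v (x + y * Complex.I) = -(N * κ) := by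
      have e : ∀ x : ℝ, remainder N k v (x + y * Complex.I) =
          (AG N k v - κ) + bulk N k v (x + y * Complex.I) := by
        intro x
        have := h (x + y * Complex.I) (by rw [him]; exact hy0)
        linear_combination -this
      simp_rw [e]
      rw [intervalIntegral.integral_add intervalIntegrable_const (intervalIntegrable_bulk hk v hy0),
        integral_bulk_eq_neg hk v hy0, intervalIntegral.integral_const, sub_zero, Complex.real_smul]
      push_cast
      ring
    rw [← hint]
    refine intervalIntegral.norm_integral_le_of_norm_le_const fun x _ => ?_
    have := hR (x + y * Complex.I) (by rw [him]; exact hy)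
    rwa [him] at this
  have hlim : Tendsto (fun y : ℝ => D * Real.exp (-c * y) * |(N : ℝ) - 0|) atTop (𝓝 0) := by
    have := ((Real.tendsto_exp_atBot.comp (tendsto_id.const_mul_atTop_of_neg
      (neg_neg_of_pos hc))).const_mul D).mul_const |(N : ℝ) - 0|
    simpa using! this
  have h0 : ‖-(N * κ)‖ ≤ 0 :=
    ge_of_tendsto hlim ((eventually_ge_atTop 1).mono hbound)
  have hκ0 : κ = 0 :=
    (mul_eq_zero.1 (neg_eq_zero.1 (norm_le_zero_iff.1 h0))).resolve_left hN
  refine sub_eq_zero.1 (eq_zero_of_ev_one (s := {0}ᶜ)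
    (Submodule.sub_mem _ (calG_mem_V k v τ) (realEis_mem_V v τ))
    (Set.finite_singleton _).infinite_compl fun t ht => ?_)
  have ht0 : t ≠ 0 := ht
  -- The vanishing is known at the points (x, 1); homogeneity carries it from (1/t, 1) to (1, t).
  have := ev_smul (Submodule.sub_mem _ (calG_mem_V k v τ) (realEis_mem_V v τ)) t t⁻¹ 1
  rw [mul_inv_cancel₀ ht0, mul_one, hκ, hκ0, mul_zero] at this
  exact this

end EisensteinPrimitive

theorem theorem5p1 (N : ℕ) [NeZero N] (k : ℕ) (hk : 3 ≤ k) (v : Fin 2 → ZMod N) :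
    (∀ τ : UpperHalfPlane,
      EisensteinPrimitive.calG N k v τ ∈ EisensteinPrimitive.V (k - 2)) ∧
    EisensteinPrimitive.IsEquivariant N (EisensteinPrimitive.calG N k v) ∧
    EisensteinPrimitive.HasDifferential (EisensteinPrimitive.calG N k v)
      (fun τ h => EisensteinPrimitive.rePoly
        (EisensteinPrimitive.form k (EisensteinPrimitive.eisG N k v) τ h)) ∧
    ∀ F : UpperHalfPlane → EisensteinPrimitive.Poly,
      (∀ τ : UpperHalfPlane, F τ ∈ EisensteinPrimitive.V (k - 2)) →
      EisensteinPrimitive.IsEquivariant N F →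
      EisensteinPrimitive.HasDifferential F
        (fun τ h => EisensteinPrimitive.rePoly
          (EisensteinPrimitive.form k (EisensteinPrimitive.eisG N k v) τ h)) →
      F = EisensteinPrimitive.calG N k v := by
  have he : EisensteinPrimitive.IsEquivariant N (EisensteinPrimitive.calG N k v) := by
    rw [EisensteinPrimitive.calG_eq_realEis hk v]
    exact EisensteinPrimitive.isEquivariant_realEis v
  have hd := EisensteinPrimitive.hasDifferential_calG hk v
  exact ⟨EisensteinPrimitive.calG_mem_V k v, he, hd, fun F hV hF hFd =>
    EisensteinPrimitive.IsEquivariant.unique (by omega) hV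
      (EisensteinPrimitive.calG_mem_V k v) hF he hFd hd⟩
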